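/- **Notation.** For $d\ge 1$ let $FM_d$ be the Fulton--MacPherson operad: $FM_d(n)$ is the closure of the image of the space of configurations of $n$ distinct labelled points of $\mathbb R^d$ under the map recording all directions $x_{ij}=\frac{p_j-p_i}{\|p_j-p_i\|}\in S^{d-1}$ ($i\neq j$) and all ratios $\frac{\|p_i-p_j\|}{\|p_i-p_k\|}\in[0,\infty]$; composition is insertion of infinitesimal configurations. Here $n=0$ is allowed, and $FM_d(0)$ and $FM_d(1)$ are points. The directions extend to continuous maps $x_{ij}\colon FM_d(n)\to S^{d-1}$. Let $FM_\infty=\operatorname{colim}_d FM_d$, with composition $\gamma$. An $E_d$-structure on a space is a continuous action of the symmetric operad $FM_d$. If $d\le e$, the underlying $E_d$-structure of an $E_e$-structure is its restriction along the inclusion $FM_d\subseteq FM_e$ induced by $\mathbb R^d=\mathbb R^d\times 0\subseteq\mathbb R^e$. Two $E_d$-structures $\theta_0,\theta_1$ on $Z$ are homotopic if there is a family of $E_d$-structures $\theta_t$, $t\in[0,1]$, joining them, such that the maps $[0,1]\times FM_d(n)\times Z^n\to Z$ are continuous for all $n$. For a space $X$ let $D_n(X)=FM_\infty(n)\times_{\Sigma_n}X^n$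 and $D(X)=\bigsqcup_{n\ge0}D_n(X)$. The classical $E_\infty$-structure on $D(X)$ is that of the free algebra, $$(p;[q_1,x_1],\dots,[q_n,x_n])\longmapsto[\gamma(p;q_1,\dots,q_n),(x_1,\dots,x_n)],$$ and the classical $E_d$-structure is its restriction to $FM_d$. Let $BU(1)=\mathbb{CP}^\infty$ and $BO(1)=\mathbb{RP}^\infty$ be the projectivizations of $\mathbb C[t]$ and $\mathbb R[t]$, with the colimit topology and the commutative product induced by multiplication of polynomials. Stereographic projection from the north pole $N$ (the last basis vector) identifies $S^2$ with $\mathbb{CP}^1=\mathbb C\cup\{\infty\}$ and $S^1$ with $\mathbb{RP}^1=\mathbb R\cup\{\infty\}$; with $z\mapsto[t-z]$ and $\infty\mapsto[1]$ this gives maps $j\colon S^2\to BU(1)$ and $j\colon S^1\to BO(1)$. For a continuous map $f\colon S^{d-1}\to M$ into a commutative topological monoid, $k_1,\dots,k_n\ge 0$ and $K=\sum_i k_i$, let $$\nu^{(f)}\colon FM_d(n)\times\prod_{i=1}^n D_{k_i}(M)\to D_K(M),$$ $$\nu^{(f)}(p;[q_1,x_1],\dots,[q_n,x_n])=[\gamma(p;q_1,\dots,q_n),(a_1x_1,\dots,a_nx_n)],\qquad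 a_i=\prod_{h\ne i}f(x_{ih}(p))^{k_h},$$ where $a_ix_i$ is obtained by multiplying every label in $x_i\in M^{k_i}$ by $a_i$. The Atiyah $E_3$-structure on $D(BU(1))$ and the Atiyah $E_2$-structure on $D(BO(1))$ are given by $\nu^{(j)}$. **Proposition.** (1) The classical and the Atiyah operations of $FM_3$ on $D(BU(1))$ are $E_3$-structures, and their underlying $E_2$-structures are homotopic. (2) The classical and the Atiyah operations of $FM_2$ on $D(BO(1))$ are $E_2$-structures, and their underlying $E_1$-structures are homotopic. More precisely, in case (1) there is a homotopy $h\colon[0,1]\times S^1\to S^2$ from the constant map $h_0=N$ to the standard inclusion $h_1\colon S^1\subset S^2$ such that $(\nu^{(j\circ h_t)})_{t\in[0,1]}$ is a homotopy of $E_2$-structures from the underlying classical structure to the underlying Atiyah structure. In case (2) the same holds, for $E_1$-structures, with $S^0\subset S^1$ in place of $S^1\subset S^2$. -/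

import Mathlib

open scoped ENNReal Topology LinearAlgebra.Projectivization Polynomial

noncomputable section

namespace AtiyahEn

/-! ### The Fulton--MacPherson operad -/

/-- Euclidean space `ℝ^d`. -/
abbrev E (d : ℕ) : Type := EuclideanSpace ℝ (Fin d)

/-- The unit sphere of `ℝ^d`; so `USphere 3` is `S^2`, `USphere 2` is `S^1`, `USphere 1` is `S^0`. -/
abbrev USphere (d : ℕ) : Type := Metric.sphere (0 : E d) 1

/-- The ambient space of the Fulton--MacPherson compactification: directions indexed by pairs of
labels, relative distances in `[0, ∞]` indexed by triples of labels. It carries the product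
topology. The coordinates with repeated indices are constant on configurations
(see `confCoord`), so keeping them does not change closures up to homeomorphism. -/
abbrev Coord (V A : Type) : Type := (A → A → V) × (A → A → A → ℝ≥0∞)

/-- The coordinates of a configuration `p`: the direction `x_{ij}` from `p_i` to `p_j`, and the
ratio `|p_i - p_j| / |p_i - p_k|`. They are constant for repeated indices: `x_{ii} = 0`, and the
ratio is `0` if `i = j`, is `∞` if `i = k ≠ j`, and is `1` if `j = k ≠ i`. -/
def confCoord {d : ℕ} {A : Type} (p : A → E d) : Coord (E d) A :=
  (fun i j => ‖p j - p i‖⁻¹ • (p j - p i), fun i j k => edist (p i) (p j) / edist (p i) (p k))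

/-- `FM d A` : the Fulton--MacPherson compactification of the space of configurations of distinct
points of `ℝ^d` labelled by `A`, modulo translations and positive dilations: the closure of the
image of the configuration space under `confCoord`. -/
def FM (d : ℕ) (A : Type) : Type :=
  {z : Coord (E d) A // z ∈ closure (confCoord '' {p : A → E d | Function.Injective p})}

instance (d : ℕ) (A : Type) : TopologicalSpace (FM d A) :=
  inferInstanceAs (TopologicalSpace {z : Coord (E d) A // z ∈ closure _})

/-- Renaming the labels of coordinates along a bijection. -/
def Coord.relabel {V A B : Type} (e : A ≃ B) (z : Coord V A) : Coord V B :=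
  (fun i j => z.1 (e.symm i) (e.symm j), fun i j k => z.2 (e.symm i) (e.symm j) (e.symm k))

open Classical in
/-- Operadic insertion in coordinates: the points with first label `a` form an infinitesimal copy
of `w a`, placed at the point of `z` with label `a`. -/
def Coord.comp {V A : Type} {B : A → Type} (z : Coord V A) (w : ∀ a, Coord V (B a)) :
    Coord V (Σ a, B a) :=
  (fun s t => if h : s.1 = t.1 then (w t.1).1 (h ▸ s.2) t.2 else z.1 s.1 t.1,
   fun s t u => if h : s.1 = u.1 ∧ t.1 = u.1 then (w u.1).2 (h.1 ▸ s.2) (h.2 ▸ t.2) u.2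
    else z.2 s.1 t.1 u.1)

/-- Coordinatewise change of the space of directions. -/
def Coord.map {V W A : Type} (f : V → W) (z : Coord V A) : Coord W A :=
  (fun i j => f (z.1 i j), z.2)

lemma continuous_relabel {V A B : Type} [TopologicalSpace V] (e : A ≃ B) :
    Continuous (Coord.relabel (V := V) e) := by
  unfold Coord.relabel
  fun_prop

lemma continuous_comp {V A : Type} [TopologicalSpace V] {B : A → Type} :
    Continuous (Function.uncurry (Coord.comp (V := V) (A := A) (B := B))) := by
  refine Continuous.prodMk ?_ ?_
  · refine continuous_pi fun s => continuous_pi fun t => ?_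
    by_cases h : s.1 = t.1
    · simp only [h, dite_true]
      fun_prop
    · simp only [h, dite_false]
      fun_prop
  · refine continuous_pi fun s => continuous_pi fun t => continuous_pi fun u => ?_
    by_cases h : s.1 = u.1 ∧ t.1 = u.1
    · simp only [h, and_self, dite_true]
      fun_prop
    · simp only [h, dite_false]
      fun_prop

lemma relabel_mem {d : ℕ} {A B : Type} (e : A ≃ B) {z : Coord (E d) A}
    (hz : z ∈ closure (confCoord '' {p : A → E d | Function.Injective p})) :
    z.relabel e ∈ closure (confCoord '' {p : B → E d | Function.Injective p}) := by
  refine map_mem_closure (continuous_relabel e) hz ?_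
  rintro _ ⟨p, hp, rfl⟩
  exact ⟨p ∘ e.symm, hp.comp e.symm.injective, rfl⟩

lemma comp_conf_mem {d : ℕ} {A : Type} [Finite A] {B : A → Type} [∀ a, Finite (B a)]
    (p : A → E d) (hp : Function.Injective p)
    (q : ∀ a, B a → E d) (hq : ∀ a, Function.Injective (q a)) :
    (confCoord p).comp (fun a => confCoord (q a)) ∈
      closure (confCoord '' {p : (Σ a, B a) → E d | Function.Injective p}) := by
  let P : ℝ → (Σ a, B a) → E d := fun ε s => p s.1 + ε • q s.1 s.2
  have hP : ∀ s, Filter.Tendsto (fun ε => P ε s) (𝓝[>] 0) (𝓝 (p s.1)) := by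
    intro s
    have : Continuous (fun ε => P ε s) := by fun_prop
    have h2 := this.tendsto 0
    simp only [P, zero_smul, add_zero] at h2
    exact h2.mono_left nhdsWithin_le_nhds
  have hpos : ∀ᶠ ε : ℝ in 𝓝[>] 0, 0 < ε := self_mem_nhdsWithin
  have hinj : ∀ᶠ ε : ℝ in 𝓝[>] 0, Function.Injective (P ε) := by
    have : ∀ᶠ ε : ℝ in 𝓝[>] 0, ∀ s t : Σ a, B a, s.1 ≠ t.1 → P ε s ≠ P ε t := by
      rw [Filter.eventually_all]
      intro s
      rw [Filter.eventually_all]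
      intro t
      by_cases h : s.1 = t.1
      · simp [h]
      · filter_upwards [((hP s).sub (hP t)).eventually_ne (sub_ne_zero.2 (hp.ne h))] with ε hε _
        exact sub_ne_zero.1 hε
    filter_upwards [this, hpos] with ε h1 h2
    intro s t hst
    by_cases h : s.1 = t.1
    · obtain ⟨a, b⟩ := s
      obtain ⟨a', b'⟩ := t
      obtain rfl : a = a' := h
      simp only [P, add_right_inj] at hst
      rw [hq a (smul_right_injective _ h2.ne' hst)]
    · exact absurd hst (h1 s t h)
  refine mem_closure_of_tendsto (b := 𝓝[>] (0 : ℝ)) (f := fun ε => confCoord (P ε)) ?_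
    (hinj.mono fun ε h => ⟨P ε, h, rfl⟩)
  refine Filter.Tendsto.prodMk_nhds ?_ ?_
  · refine tendsto_pi_nhds.2 fun s => tendsto_pi_nhds.2 fun t => ?_
    by_cases h : s.1 = t.1
    · obtain ⟨a, b⟩ := s
      obtain ⟨a', b'⟩ := t
      obtain rfl : a = a' := h
      refine Filter.Tendsto.congr' ?_ tendsto_const_nhds
      filter_upwards [hpos] with ε hε
      simp only [confCoord, P, dite_true, add_sub_add_left_eq_sub, ← smul_sub,
        norm_smul, Real.norm_of_nonneg hε.le, mul_inv, smul_smul]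
      congr 1
      field_simp
    · simp only [confCoord, h, dite_false]
      have h3 := (hP t).sub (hP s)
      exact (h3.norm.inv₀ (norm_ne_zero_iff.2 (sub_ne_zero.2 (hp.ne (Ne.symm h))))).smul h3
  · refine tendsto_pi_nhds.2 fun s => tendsto_pi_nhds.2 fun t => tendsto_pi_nhds.2 fun u => ?_
    by_cases h : s.1 = u.1 ∧ t.1 = u.1
    · obtain ⟨a, b⟩ := s
      obtain ⟨a', b'⟩ := t
      obtain ⟨a'', b''⟩ := u
      obtain ⟨rfl, h2⟩ := h
      obtain rfl : a' = a := h2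
      refine Filter.Tendsto.congr' ?_ tendsto_const_nhds
      filter_upwards [hpos] with ε hε
      have e1 : ENNReal.ofReal ε ≠ 0 := by simpa using hε
      have key : ∀ x y : B a', edist (P ε ⟨a', x⟩) (P ε ⟨a', y⟩)
          = ENNReal.ofReal ε * edist (q a' x) (q a' y) := by
        intro x y
        simp only [P, edist_add_left]
        rw [edist_smul₀]
        rw [← Real.enorm_eq_ofReal hε.le]
        rfl
      simp only [confCoord, and_self, dite_true, key]
      rw [ENNReal.mul_div_mul_left _ _ e1 ENNReal.ofReal_ne_top]
    · simp only [confCoord, h, dite_false]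
      refine ENNReal.Tendsto.div ((hP s).edist (hP t)) ?_ ((hP s).edist (hP u)) ?_
      · by_contra! hc
        simp only [edist_eq_zero] at hc
        exact h ⟨hp hc.2, (hp hc.1).symm.trans (hp hc.2)⟩
      · exact Or.inl (edist_ne_top _ _)

lemma comp_mem {d : ℕ} {A : Type} [Finite A] {B : A → Type} [∀ a, Finite (B a)]
    {z : Coord (E d) A} {w : ∀ a, Coord (E d) (B a)}
    (hz : z ∈ closure (confCoord '' {p : A → E d | Function.Injective p}))
    (hw : ∀ a, w a ∈ closure (confCoord '' {p : B a → E d | Function.Injective p})) :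
    z.comp w ∈ closure (confCoord '' {p : (Σ a, B a) → E d | Function.Injective p}) := by
  rw [← closure_closure]
  have hw' : w ∈ closure (Set.univ.pi fun a =>
      confCoord '' {p : B a → E d | Function.Injective p}) := by
    rw [closure_pi_set]
    exact fun a _ => hw a
  refine map_mem_closure₂ continuous_comp hz hw' ?_
  rintro _ ⟨p, hp, rfl⟩ w hw
  choose q hq hqw using fun a => hw a (Set.mem_univ a)
  obtain rfl : (fun a => confCoord (q a)) = w := funext hqw
  exact comp_conf_mem p hp q hq

/-- The inclusion `ℝ^d ⊆ ℝ^e` for `d ≤ e`: extension by zero. -/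
def pad (d e : ℕ) (v : E d) : E e :=
  WithLp.toLp 2 fun k => if h : (k : ℕ) < d then v ⟨k, h⟩ else 0

lemma pad_sub (d e : ℕ) (v w : E d) : pad d e (v - w) = pad d e v - pad d e w := by
  ext k
  by_cases h : (k : ℕ) < d <;> simp [pad, h]

lemma pad_smul (d e : ℕ) (c : ℝ) (v : E d) : pad d e (c • v) = c • pad d e v := by
  ext k
  by_cases h : (k : ℕ) < d <;> simp [pad, h]

lemma continuous_pad (d e : ℕ) : Continuous (pad d e) := by
  refine (PiLp.continuous_toLp 2 _).comp (continuous_pi fun k => ?_)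
  by_cases h : (k : ℕ) < d
  · simp only [h, dite_true]
    fun_prop
  · simp only [h, dite_false]
    fun_prop

lemma norm_pad {d e : ℕ} (hde : d ≤ e) (v : E d) : ‖pad d e v‖ = ‖v‖ := by
  rw [EuclideanSpace.norm_eq, EuclideanSpace.norm_eq]
  congr 1
  have : ∀ k : Fin e, ‖pad d e v k‖ ^ 2
      = (fun k : ℕ => if h : k < d then ‖v ⟨k, h⟩‖ ^ 2 else 0) k := by
    intro k
    by_cases h : (k : ℕ) < d <;> simp [pad, h]
  rw [Finset.sum_congr rfl fun k _ => this k, Fin.sum_univ_eq_sum_range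
    (fun k : ℕ => if h : k < d then ‖v ⟨k, h⟩‖ ^ 2 else 0)]
  rw [← Finset.sum_subset (Finset.range_subset_range.2 hde)
    (fun x _ hx => by simp at hx; simp [hx]), ← Fin.sum_univ_eq_sum_range
    (fun k : ℕ => if h : k < d then ‖v ⟨k, h⟩‖ ^ 2 else 0)]
  simp

lemma map_pad_mem {d e : ℕ} (hde : d ≤ e) {A : Type} {z : Coord (E d) A}
    (hz : z ∈ closure (confCoord '' {p : A → E d | Function.Injective p})) :
    z.map (pad d e) ∈ closure (confCoord '' {p : A → E e | Function.Injective p}) := by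
  have hc : Continuous (Coord.map (A := A) (pad d e)) := by
    have := continuous_pad d e
    unfold Coord.map
    fun_prop
  refine map_mem_closure hc hz ?_
  have hedist : ∀ v w : E d, edist (pad d e v) (pad d e w) = edist v w := by
    intro v w
    rw [edist_dist, edist_dist, dist_eq_norm, dist_eq_norm, ← pad_sub, norm_pad hde]
  rintro _ ⟨p, hp, rfl⟩
  refine ⟨fun a => pad d e (p a), fun a b hab => hp ?_, ?_⟩
  · have := hedist (p a) (p b)
    rw [show pad d e (p a) = pad d e (p b) from hab, edist_self] at this
    exact edist_eq_zero.1 this.symm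
  · simp only [confCoord, Coord.map, ← pad_sub, norm_pad hde, pad_smul, hedist]

/-- The action of bijections of labels on `FM d`: the point labelled `a` gets the label `e a`. -/
def FM.relabel {d : ℕ} {A B : Type} (e : A ≃ B) (p : FM d A) : FM d B :=
  ⟨p.1.relabel e, relabel_mem e p.2⟩

/-- Operadic composition of `FM d`, for arbitrary finite label sets. -/
def FM.sigmaComp {d : ℕ} {A : Type} [Finite A] {B : A → Type} [∀ a, Finite (B a)]
    (p : FM d A) (q : ∀ a, FM d (B a)) : FM d (Σ a, B a) :=
  ⟨p.1.comp fun a => (q a).1, comp_mem p.2 fun a => (q a).2⟩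

/-- Operadic composition
`FM d (n) × FM d (k_1) × ⋯ × FM d (k_n) → FM d (k_1 + ⋯ + k_n)`; the labels are ordered
block after block. -/
def FM.gamma {d n : ℕ} {k : Fin n → ℕ} (p : FM d (Fin n)) (q : ∀ i, FM d (Fin (k i))) :
    FM d (Fin (∑ i, k i)) :=
  (p.sigmaComp q).relabel finSigmaFinEquiv

/-- The operadic unit, the class of the one-point configuration. -/
def FM.unit (d : ℕ) : FM d (Fin 1) :=
  ⟨confCoord fun _ => 0, subset_closure ⟨_, Function.injective_of_subsingleton _, rfl⟩⟩

/-- The inclusion `FM d (A) → FM e (A)` induced by `ℝ^d ⊆ ℝ^e`. -/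
def FM.incl {d e : ℕ} (hde : d ≤ e) {A : Type} (p : FM d A) : FM e A :=
  ⟨p.1.map (pad d e), map_pad_mem hde p.2⟩

lemma norm_dir {d : ℕ} {A : Type} (p : FM d A) {i j : A} (h : i ≠ j) : ‖p.1.1 i j‖ = 1 := by
  have hc : IsClosed {z : Coord (E d) A | ‖z.1 i j‖ = 1} :=
    isClosed_eq (by fun_prop) continuous_const
  refine closure_minimal ?_ hc p.2
  rintro _ ⟨q, hq, rfl⟩
  have : ‖q j - q i‖ ≠ 0 := norm_ne_zero_iff.2 (sub_ne_zero.2 (hq.ne h.symm))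
  simp [confCoord, norm_smul, this]

/-- The direction `x_{ij} : FM d (A) → S^{d-1}`, the continuous extension of
`(p_j - p_i) / |p_j - p_i|`. -/
def FM.dir {d : ℕ} {A : Type} (p : FM d A) (i j : A) (h : i ≠ j) : USphere d :=
  ⟨p.1.1 i j, by simpa using norm_dir p h⟩

/-! ### The operad `FM_∞` -/

/-- The inclusion of `ℝ^d` in `ℝ^∞` (finitely supported sequences): extension by zero. -/
def padInf (d : ℕ) (v : E d) : ℕ → ℝ := fun k => if h : k < d then v ⟨k, h⟩ else 0

/-- `FM_∞(A)`, the union of the `FM d (A)` along the standard inclusions. -/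
def FMInf (A : Type) : Type :=
  {z : Coord (ℕ → ℝ) A // ∃ (d : ℕ) (p : FM d A), p.1.map (padInf d) = z}

/-- The inclusion of `FM d (A)` in `FM_∞(A)`. -/
def FM.toInf {d : ℕ} {A : Type} (p : FM d A) : FMInf A := ⟨p.1.map (padInf d), d, p, rfl⟩

/-- `FM_∞(A)` carries the colimit topology. -/
instance (A : Type) : TopologicalSpace (FMInf A) :=
  ⨆ d : ℕ, TopologicalSpace.coinduced (FM.toInf (d := d) (A := A)) inferInstance

lemma padInf_pad {d e : ℕ} (hde : d ≤ e) (v : E d) : padInf e (pad d e v) = padInf d v := by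
  funext k
  by_cases h : k < d
  · simp [padInf, pad, h, h.trans_le hde]
  · by_cases h' : k < e <;> simp [padInf, pad, h, h']

lemma FMInf.exists_of_le {A : Type} (z : FMInf A) :
    ∃ d : ℕ, ∀ e, d ≤ e → ∃ p : FM e A, p.1.map (padInf e) = z.1 := by
  obtain ⟨z, d, p, rfl⟩ := z
  refine ⟨d, fun e hde => ⟨p.incl hde, ?_⟩⟩
  simp only [FM.incl, Coord.map, padInf_pad hde]

lemma map_comp {V W A : Type} {B : A → Type} (f : V → W) (z : Coord V A)
    (w : ∀ a, Coord V (B a)) :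
    (z.comp w).map f = (z.map f).comp fun a => (w a).map f := by
  refine Prod.ext ?_ rfl
  funext s t
  by_cases h : s.1 = t.1 <;> simp [Coord.comp, Coord.map, h]

/-- The action of bijections of labels on `FM_∞`. -/
def FMInf.relabel {A B : Type} (e : A ≃ B) (p : FMInf A) : FMInf B :=
  ⟨p.1.relabel e, by
    obtain ⟨_, d, p, rfl⟩ := p
    exact ⟨d, p.relabel e, rfl⟩⟩

/-- Operadic composition of `FM_∞`, for arbitrary finite label sets. -/
def FMInf.sigmaComp {A : Type} [Finite A] {B : A → Type} [∀ a, Finite (B a)]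
    (p : FMInf A) (q : ∀ a, FMInf (B a)) : FMInf (Σ a, B a) :=
  ⟨p.1.comp fun a => (q a).1, by
    cases nonempty_fintype A
    obtain ⟨d, hd⟩ := p.exists_of_le
    choose D hD using fun a => (q a).exists_of_le
    obtain ⟨p', hp'⟩ := hd (max d (Finset.univ.sup D)) (le_max_left _ _)
    choose q' hq' using fun a => hD a (max d (Finset.univ.sup D))
      ((Finset.le_sup (Finset.mem_univ a)).trans (le_max_right _ _))
    refine ⟨_, p'.sigmaComp q', ?_⟩
    rw [FM.sigmaComp, map_comp, hp']
    simp only [hq']⟩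

/-- Operadic composition of `FM_∞`; the labels are ordered block after block. -/
def FMInf.gamma {n : ℕ} {k : Fin n → ℕ} (p : FMInf (Fin n)) (q : ∀ i, FMInf (Fin (k i))) :
    FMInf (Fin (∑ i, k i)) :=
  (p.sigmaComp q).relabel finSigmaFinEquiv

/-! ### Extended powers and the free `E_∞`-algebra -/

/-- The orbit relation of the diagonal action of the symmetric group on `FM_∞(n) × X^n`. -/
def extPowSetoid (n : ℕ) (X : Type) : Setoid (FMInf (Fin n) × (Fin n → X)) where
  r a b := ∃ σ : Equiv.Perm (Fin n), a.1.relabel σ = b.1 ∧ a.2 ∘ σ.symm = b.2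
  iseqv :=
    { refl := fun a => ⟨1, rfl, rfl⟩
      symm := by
        rintro ⟨p, x⟩ ⟨q, y⟩ ⟨σ, h1, h2⟩
        dsimp only at h1 h2
        subst h1 h2
        refine ⟨σ.symm, Subtype.ext ?_, ?_⟩
        · simp [FMInf.relabel, Coord.relabel]
        · funext i
          simp
      trans := by
        rintro ⟨p, x⟩ ⟨q, y⟩ ⟨r, z⟩ ⟨σ, h1, h2⟩ ⟨τ, h3, h4⟩
        dsimp only at h1 h2 h3 h4
        subst h1 h2 h3 h4
        exact ⟨σ.trans τ, rfl, rfl⟩ }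

/-- The extended symmetric power `D_n(X) = FM_∞(n) ×_{Σ_n} X^n`. -/
def ExtPow (n : ℕ) (X : Type) : Type := Quotient (extPowSetoid n X)

instance (n : ℕ) (X : Type) [TopologicalSpace X] : TopologicalSpace (ExtPow n X) :=
  inferInstanceAs (TopologicalSpace (Quotient (extPowSetoid n X)))

/-- `D(X) = ⊔_n D_n(X)`. -/
abbrev D (X : Type) : Type := Σ n : ℕ, ExtPow n X

/-- The composition `γ` of `FM_∞` together with concatenation of labels. -/
def glue {X : Type} {n : ℕ} {k : Fin n → ℕ} (p : FMInf (Fin n))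
    (q : ∀ i, FMInf (Fin (k i)) × (Fin (k i) → X)) :
    FMInf (Fin (∑ i, k i)) × (Fin (∑ i, k i) → X) :=
  (p.gamma fun i => (q i).1,
   fun s => (q (finSigmaFinEquiv.symm s).1).2 (finSigmaFinEquiv.symm s).2)

lemma glue_rel {X : Type} {n : ℕ} {k : Fin n → ℕ} (p : FMInf (Fin n))
    (q r : ∀ i, FMInf (Fin (k i)) × (Fin (k i) → X))
    (h : ∀ i, (extPowSetoid (k i) X).r (q i) (r i)) :
    (extPowSetoid (∑ i, k i) X).r (glue p q) (glue p r) := by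
  choose σ h1 h2 using h
  have key : ∀ s, finSigmaFinEquiv.symm
      ((finSigmaFinEquiv.permCongr (Equiv.sigmaCongrRight σ)).symm s) =
      ⟨(finSigmaFinEquiv.symm s).1,
        (σ (finSigmaFinEquiv.symm s).1).symm (finSigmaFinEquiv.symm s).2⟩ := by
    intro s
    rw [Equiv.symm_apply_eq, Equiv.symm_apply_eq]
    simp [Equiv.permCongr_apply, Equiv.sigmaCongrRight]
  refine ⟨finSigmaFinEquiv.permCongr (Equiv.sigmaCongrRight σ), ?_, ?_⟩
  · refine Subtype.ext (Prod.ext ?_ ?_)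
    · funext s t
      simp only [glue, FMInf.gamma, FMInf.relabel, FMInf.sigmaComp, Coord.relabel, ← h1, key]
      generalize finSigmaFinEquiv.symm s = s'
      generalize finSigmaFinEquiv.symm t = t'
      obtain ⟨i, a⟩ := s'
      obtain ⟨j, b⟩ := t'
      by_cases hij : i = j
      · subst hij
        simp [Coord.comp]
      · simp [Coord.comp, hij]
    · funext s t u
      simp only [glue, FMInf.gamma, FMInf.relabel, FMInf.sigmaComp, Coord.relabel, ← h1, key]
      generalize finSigmaFinEquiv.symm s = s'
      generalize finSigmaFinEquiv.symm t = t'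
      generalize finSigmaFinEquiv.symm u = u'
      obtain ⟨i, a⟩ := s'
      obtain ⟨j, b⟩ := t'
      obtain ⟨l, c⟩ := u'
      by_cases hij : i = l ∧ j = l
      · obtain ⟨rfl, rfl⟩ := hij
        simp [Coord.comp]
      · simp [Coord.comp, hij]
  · funext s
    simp only [glue, Function.comp_apply, ← h2]
    rw [key]

/-- The classical action of `FM_∞` on `D(X)`, as the free algebra on `X`:
`(p; [q_1, x_1], …, [q_n, x_n]) ↦ [γ(p; q_1, …, q_n), (x_1, …, x_n)]`. -/
def freeAct {X : Type} {n : ℕ} (p : FMInf (Fin n)) (y : Fin n → D X) : D X :=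
  ⟨∑ i, (y i).1, Quotient.finLiftOn (S := fun i => extPowSetoid (y i).1 X) (fun i => (y i).2)
    (fun q => (Quotient.mk (extPowSetoid _ X) (glue p q) : ExtPow (∑ i, (y i).1) X))
    fun q r h => Quotient.sound (glue_rel p q r h)⟩

/-- For a monoid `M` of labels, multiplication of all the labels by `a` on the left. -/
def scale {M : Type} [Mul M] (a : M) (y : D M) : D M :=
  ⟨y.1, Quotient.map (sa := extPowSetoid y.1 M) (sb := extPowSetoid y.1 M)
    (fun q => (q.1, fun s => a * q.2 s))
    (by
      rintro ⟨p, x⟩ ⟨q, z⟩ ⟨σ, h1, h2⟩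
      dsimp only at h1 h2
      subst h1 h2
      exact ⟨σ, rfl, rfl⟩) y.2⟩

/-! ### Algebras over the Fulton--MacPherson operad and their homotopies -/

/-- Families of operations on `X` parametrized by `FM d`. -/
abbrev FMAction (d : ℕ) (X : Type) : Type := ∀ n : ℕ, FM d (Fin n) → (Fin n → X) → X

/-- The operations define a (continuous) action of the symmetric operad `FM d` on the space `X`,
that is, an `E_d`-structure. -/
structure IsFMAlgebra (d : ℕ) (X : Type) [TopologicalSpace X] (θ : FMAction d X) : Prop where
  continuous : ∀ n, Continuous fun z : FM d (Fin n) × (Fin n → X) => θ n z.1 z.2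
  unit : ∀ x : X, θ 1 (FM.unit d) (fun _ => x) = x
  equivariant : ∀ (n : ℕ) (σ : Equiv.Perm (Fin n)) (p : FM d (Fin n)) (x : Fin n → X),
    θ n (p.relabel σ) x = θ n p (x ∘ σ)
  assoc : ∀ (n : ℕ) (k : Fin n → ℕ) (p : FM d (Fin n)) (q : ∀ i, FM d (Fin (k i)))
    (x : Fin (∑ i, k i) → X),
    θ (∑ i, k i) (p.gamma q) x =
      θ n p fun i => θ (k i) (q i) fun j => x (finSigmaFinEquiv ⟨i, j⟩)

/-- The underlying `E_d`-structure of an `E_e`-structure, `d ≤ e`. -/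
def FMAction.restrict {d e : ℕ} (hde : d ≤ e) {X : Type} (θ : FMAction e X) : FMAction d X :=
  fun n p x => θ n (p.incl hde) x

/-- `H` is a homotopy of `E_d`-structures on `X` from `θ₀` to `θ₁`: a jointly continuous
family, parametrized by `[0,1]`, of `E_d`-structures. -/
structure IsFMHomotopy (d : ℕ) (X : Type) [TopologicalSpace X] (θ₀ θ₁ : FMAction d X)
    (H : unitInterval → FMAction d X) : Prop where
  isFMAlgebra : ∀ t, IsFMAlgebra d X (H t)
  continuous : ∀ n, Continuous fun z : unitInterval × FM d (Fin n) × (Fin n → X) =>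
    H z.1 n z.2.1 z.2.2
  zero : H 0 = θ₀
  one : H 1 = θ₁

/-! ### `BU(1)` and `BO(1)` -/

/-- The infinite projective space over `K`, as the projectivization of the space of polynomials.
It is `BU(1) = ℂP^∞` for `K = ℂ` and `BO(1) = ℝP^∞` for `K = ℝ`. -/
def ProjPoly (K : Type) [Field K] : Type := ℙ K K[X]

/-- The polynomial with given coefficients. -/
def ofCoeffs {K : Type} [Field K] {n : ℕ} (v : Fin n → K) : K[X] :=
  ∑ i : Fin n, Polynomial.monomial (i : ℕ) (v i)

lemma ofCoeffs_ne_zero {K : Type} [Field K] {n : ℕ} {v : Fin n → K} (hv : v ≠ 0) :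
    ofCoeffs v ≠ 0 := by
  obtain ⟨i, hi⟩ := Function.ne_iff.1 hv
  intro h
  apply hi
  have := congrArg (fun f => f.coeff (i : ℕ)) h
  simpa [ofCoeffs, Polynomial.coeff_monomial, Fin.val_inj] using this

/-- The colimit topology on the union of the finite projective spaces: the finest topology such
that all maps `K^n ∖ {0} → KP^{n-1} ⊆ KP^∞` are continuous. -/
instance (K : Type) [Field K] [TopologicalSpace K] : TopologicalSpace (ProjPoly K) :=
  ⨆ n : ℕ, TopologicalSpace.coinduced
    (fun v : {v : Fin n → K // v ≠ 0} =>
      (Projectivization.mk K (ofCoeffs v.1) (ofCoeffs_ne_zero v.2) : ProjPoly K))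
    inferInstance

/-- The multiplication `[f][g] = [fg]`. -/
instance (K : Type) [Field K] : CommMonoid (ProjPoly K) where
  mul := Quotient.map₂ (fun f g => ⟨f.1 * g.1, mul_ne_zero f.2 g.2⟩) (by
    rintro ⟨f, hf⟩ ⟨f', hf'⟩ ⟨a, ha⟩ ⟨g, hg⟩ ⟨g', hg'⟩ ⟨b, hb⟩
    refine ⟨a * b, ?_⟩
    simp only [Units.smul_def, Units.val_mul] at ha hb ⊢
    rw [← ha, ← hb, smul_mul_smul_comm])
  one := Projectivization.mk K 1 one_ne_zero
  mul_assoc := by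
    rintro ⟨f⟩ ⟨g⟩ ⟨h⟩
    exact congrArg (Quotient.mk _) (Subtype.ext (mul_assoc _ _ _))
  mul_comm := by
    rintro ⟨f⟩ ⟨g⟩
    exact congrArg (Quotient.mk _) (Subtype.ext (mul_comm _ _))
  one_mul := by
    rintro ⟨f⟩
    exact congrArg (Quotient.mk _) (Subtype.ext (one_mul _))
  mul_one := by
    rintro ⟨f⟩
    exact congrArg (Quotient.mk _) (Subtype.ext (mul_one _))

/-- `BU(1)`. -/
abbrev BU1 : Type := ProjPoly ℂ

/-- `BO(1)`. -/
abbrev BO1 : Type := ProjPoly ℝ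

/-- The class of the linear polynomial with root `z`. -/
def linClass {K : Type} [Field K] (z : K) : ProjPoly K :=
  Projectivization.mk K (Polynomial.X - Polynomial.C z) (Polynomial.X_sub_C_ne_zero z)

open Classical in
/-- `S^2 ≅ ℂP^1 ⊆ BU(1)`: stereographic projection from the north pole `(0,0,1)` identifies the
sphere with `ℂ ∪ {∞}`; a point `z` of `ℂ` is sent to `[X - z]` and `∞` to `[1]`. -/
def sphereToBU1 (v : USphere 3) : BU1 :=
  if v.1 2 = 1 then 1 else linClass (((v.1 0 : ℂ) + (v.1 1 : ℂ) * Complex.I) / (1 - (v.1 2 : ℂ)))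

open Classical in
/-- `S^1 ≅ ℝP^1 ⊆ BO(1)`, via stereographic projection from the north pole `(0,1)`. -/
def sphereToBO1 (v : USphere 2) : BO1 :=
  if v.1 1 = 1 then 1 else linClass (v.1 0 / (1 - v.1 1))

/-! ### The classical and the Atiyah structures -/

/-- The classical `E_d`-structure on `D(X)`: the free `E_∞`-structure restricted to `FM d`. -/
def classicalAct (d : ℕ) (X : Type) : FMAction d (D X) := fun _ p y => freeAct p.toInf y

/-- The weighted Atiyah map associated with `f : S^{d-1} → M`, where `M` is a commutative monoid:
its `i`-th component is the product of the `f(x_{ij})^{w_j}` over `j ≠ i`. -/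
def weightedMap {d n : ℕ} {M : Type} [CommMonoid M] (f : USphere d → M) (w : Fin n → ℕ)
    (p : FM d (Fin n)) (i : Fin n) : M :=
  ∏ j : {j : Fin n // j ≠ i}, f (p.dir i j.1 j.2.symm) ^ w j.1

/-- The operations `ν^{(f)}` on `D(M)`: the classical ones, after multiplying the labels of the
`i`-th argument by the `i`-th component of the weighted Atiyah map; the weights are the numbers
of points of the arguments. -/
def twistedAct {d : ℕ} {M : Type} [CommMonoid M] (f : USphere d → M) : FMAction d (D M) :=
  fun _ p y => freeAct p.toInf fun i => scale (weightedMap f (fun j => (y j).1) p i) (y i)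

/-- The Atiyah `E_3`-structure on `D(BU(1))`. -/
def atiyahComplex : FMAction 3 (D BU1) := twistedAct sphereToBU1

/-- The Atiyah `E_2`-structure on `D(BO(1))`. -/
def atiyahReal : FMAction 2 (D BO1) := twistedAct sphereToBO1

/-- The standard inclusion `S^{d-1} ⊆ S^{e-1}` for `d ≤ e`. -/
def sphereIncl {d e : ℕ} (hde : d ≤ e) (v : USphere d) : USphere e :=
  ⟨pad d e v.1, by simp [norm_pad hde]⟩

/-- The north pole of the unit sphere of `ℝ^{d+1}`, the last basis vector. -/
def northPole (d : ℕ) : USphere (d + 1) :=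
  ⟨EuclideanSpace.single (Fin.last d) 1, by simp⟩

end AtiyahEn

end

open scoped ENNReal Topology LinearAlgebra.Projectivization Polynomial

noncomputable section

namespace AtiyahEn

/-! ### Sequential colimits of locally compact spaces -/

/-! The operations `ν^{(f)}` form an `E_d`-structure for every continuous map `f` from the sphere to
a commutative topological monoid, and they depend continuously on `f`. This reduces the homotopy of
structures to a homotopy of maps of spheres. Rotating along meridians deforms the equator to the
north pole `N`. As `j(N) = 1`, the twist is trivial at time 0 (`twistedAct_one`), while at time 1 it
is the restriction of the Atiyah twist (`restrict_twistedAct`).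

The algebraic core is associativity. In an operadic composite the direction between points of
different blocks is a direction of the outer configuration, and the direction between points of one
block is a direction of the inner one. Hence the scaling factor of a point in the composite is the
outer factor times the inner factor (`weightedMap_gamma`), because `∏ f(x)^{w_b} = f(x)^{∑ w_b}` and
the number of points is additive under composition. Unit and equivariance are immediate from the
product formula for the factor.

The topological core is continuity, where colimits and quotients have to be exchanged with products.
`FM_∞` is a sequential colimit of compact Hausdorff spaces, and the nonzero polynomials are one of
the locally compact spaces `K^n ∖ {0}`. Such colimits commute with finite products
(`IsSeqColimit.pi`) and with multiplication by a locally compact space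
(`IsSeqColimit.continuous_prod`). The quotients, by symmetric groups and by scalars, are orbit maps
of group actions and therefore open, and finite products of open maps are open. It remains to see
that `j` is continuous at the pole, which follows from a second system of homogeneous coordinates
(`continuous_stereographic`). -/

/-- `X` carries the colimit topology of the sequence of spaces `C n` with transition maps `c n`,
where the maps `ι n` to `X` are injective. -/
structure IsSeqColimit {X : Type*} [TopologicalSpace X] (C : ℕ → Type*)
    [∀ n, TopologicalSpace (C n)] (c : ∀ n, C n → C (n + 1)) (ι : ∀ n, C n → X) : Prop where
  continuous_trans : ∀ n, Continuous (c n)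
  comp_trans : ∀ n x, ι (n + 1) (c n x) = ι n x
  injective : ∀ n, Function.Injective (ι n)
  exists_rep : ∀ x, ∃ n a, ι n a = x
  isOpen_iff : ∀ U : Set X, IsOpen U ↔ ∀ n, IsOpen (ι n ⁻¹' U)

namespace IsSeqColimit

section basic

variable {X : Type*} [TopologicalSpace X] {C : ℕ → Type*} [∀ n, TopologicalSpace (C n)]
  {c : ∀ n, C n → C (n + 1)} {ι : ∀ n, C n → X}

lemma continuous_ι (h : IsSeqColimit C c ι) (n : ℕ) : Continuous (ι n) :=
  ⟨fun _ hU => (h.isOpen_iff _).1 hU n⟩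

lemma continuous_iff (h : IsSeqColimit C c ι) {Y : Type*} [TopologicalSpace Y] {f : X → Y} :
    Continuous f ↔ ∀ n, Continuous (f ∘ ι n) :=
  ⟨fun hf n => hf.comp (h.continuous_ι n), fun hf =>
    ⟨fun _ hU => (h.isOpen_iff _).2 fun n => hU.preimage (hf n)⟩⟩

lemma exists_trans (h : IsSeqColimit C c ι) {n m : ℕ} (hnm : n ≤ m) :
    ∃ g : C n → C m, Continuous g ∧ ∀ x, ι m (g x) = ι n x := by
  induction m, hnm using Nat.le_induction with
  | base => exact ⟨id, continuous_id, fun _ => rfl⟩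
  | succ m _ ih =>
    obtain ⟨g, hg, hg'⟩ := ih
    exact ⟨c m ∘ g, (h.continuous_trans m).comp hg, fun x => (h.comp_trans m _).trans (hg' x)⟩

/-- Multiplication by a locally compact space preserves sequential colimits. -/
lemma continuous_prod (h : IsSeqColimit C c ι) {Y Z : Type*} [TopologicalSpace Y]
    [LocallyCompactSpace Y] [TopologicalSpace Z] {f : Y × X → Z}
    (hf : ∀ n, Continuous fun z : Y × C n => f (z.1, ι n z.2)) : Continuous f := by
  have hfx : ∀ x, Continuous fun y => f (y, x) := by
    intro x
    obtain ⟨n, a, rfl⟩ := h.exists_rep x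
    exact (hf n).comp (by fun_prop : Continuous fun y : Y => (y, a))
  -- Currying moves the problem to maps out of the colimit alone. Local compactness of `Y` is what
  -- permits uncurrying at the end.
  let F : X → C(Y, Z) := fun x => ⟨fun y => f (y, x), hfx x⟩
  have hF : Continuous F := by
    refine h.continuous_iff.2 fun n => ?_
    refine ContinuousMap.continuous_of_continuous_uncurry _ ?_
    exact (hf n).comp continuous_swap
  exact (ContinuousMap.continuous_uncurry_of_continuous ⟨F, hF⟩).comp continuous_swap

end basic

end IsSeqColimit

/-- In a finite product of locally compact spaces, a box of compact sets contained in an open set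
lies in the interior of a larger box of compact sets contained in that set. -/
lemma exists_compact_box_between {I : Type*} [Finite I] {C : I → Type*}
    [∀ i, TopologicalSpace (C i)] [∀ i, LocallyCompactSpace (C i)] {K : ∀ i, Set (C i)}
    (hK : ∀ i, IsCompact (K i)) {W : Set (∀ i, C i)} (hW : IsOpen W)
    (hKW : Set.univ.pi K ⊆ W) :
    ∃ L : ∀ i, Set (C i), (∀ i, IsCompact (L i)) ∧ (∀ i, K i ⊆ interior (L i)) ∧
      Set.univ.pi L ⊆ W := by
  classical
  cases nonempty_fintype I
  suffices H : ∀ s : Finset I, ∃ L : ∀ i, Set (C i), (∀ i, IsCompact (L i)) ∧ (∀ i, K i ⊆ L i) ∧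
      (∀ i ∈ s, K i ⊆ interior (L i)) ∧ Set.univ.pi L ⊆ W by
    obtain ⟨L, h1, -, h3, h4⟩ := H Finset.univ
    exact ⟨L, h1, fun i => h3 i (Finset.mem_univ i), h4⟩
  intro s
  induction s using Finset.induction_on with
  | empty => exact ⟨K, hK, fun _ => subset_rfl, by simp, hKW⟩
  | insert i s _ ih =>
    obtain ⟨L, h1, h2, h3, h4⟩ := ih
    -- The factors are enlarged one at a time. A point `a` of `L i` is needed below to fill the
    -- `i`-th coordinate; if there is none, `K i` is empty and nothing has to be enlarged.
    obtain hL | ⟨a, ha⟩ := (L i).eq_empty_or_nonempty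
    · refine ⟨L, h1, h2, fun j hj => ?_, h4⟩
      obtain rfl | hj := Finset.mem_insert.1 hj
      · exact ((h2 j).trans hL.le).trans (Set.empty_subset _)
      · exact h3 j hj
    -- `F` overwrites the `i`-th coordinate, so that the tube lemma for two factors applies to `L i`
    -- and the whole box.
    let F : C i × (∀ j, C j) → ∀ j, C j := fun z => Function.update z.2 i z.1
    have hF : Continuous F := continuous_snd.update i continuous_fst
    obtain ⟨u, v, hu, -, hLu, hLv, huv⟩ := generalized_tube_lemma (h1 i)
      (isCompact_univ_pi h1) (hW.preimage hF) (by
        rintro ⟨a, x⟩ ⟨ha, hx⟩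
        refine h4 fun j _ => ?_
        by_cases hj : j = i
        · subst hj
          simpa [F] using ha
        · simpa [F, hj] using hx j trivial)
    obtain ⟨M, hM, hKM, hMu⟩ := exists_compact_between (h1 i) hu hLu
    refine ⟨Function.update L i M, fun j => ?_, fun j => ?_, fun j hj => ?_, fun x hx => ?_⟩
    · by_cases hj : j = i
      · subst hj
        simpa using hM
      · simpa [hj] using h1 j
    · by_cases hj : j = i
      · subst hj
        simpa using (h2 j).trans (hKM.trans interior_subset)
      · simpa [hj] using h2 j
    · by_cases hji : j = i
      · subst hji
        simpa using (h2 j).trans hKM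
      · simpa [hji] using h3 j (Finset.mem_of_mem_insert_of_ne hj hji)
    -- The `i`-th coordinate of `x` may lie outside `L i`; replacing it by `a` puts the point in the
    -- old box, and `F` then restores `x i`.
    · have hx' : Function.update x i a ∈ v := hLv fun j _ => by
        by_cases hj : j = i
        · subst hj
          simpa using ha
        · simpa [hj] using hx j trivial
      have hxi : x i ∈ u := hMu (by simpa using hx i trivial)
      simpa [F] using huv (Set.mk_mem_prod hxi hx')

/-- Finitely many coordinates have representatives at finitely many stages, all of which map to the
largest one. -/
lemma IsSeqColimit.exists_rep_pi {I : Type*} [Finite I] {X : I → Type*}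
    [∀ i, TopologicalSpace (X i)] {C : I → ℕ → Type*} [∀ i n, TopologicalSpace (C i n)]
    {c : ∀ i n, C i n → C i (n + 1)} {ι : ∀ i n, C i n → X i}
    (h : ∀ i, IsSeqColimit (C i) (c i) (ι i)) (x : ∀ i, X i) :
    ∃ n, ∃ a : ∀ i, C i n, (fun i => ι i n (a i)) = x := by
  cases nonempty_fintype I
  choose n a ha using fun i => (h i).exists_rep (x i)
  choose g _ hg using fun i => (h i).exists_trans (Finset.le_sup (f := n) (Finset.mem_univ i))
  exact ⟨Finset.univ.sup n, fun i => g i (a i), funext fun i => (hg i _).trans (ha i)⟩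

/-- Finite products of sequential colimits of locally compact spaces are the sequential colimits
of the products. -/
lemma IsSeqColimit.pi {I : Type*} [Finite I] {X : I → Type*} [∀ i, TopologicalSpace (X i)]
    {C : I → ℕ → Type*} [∀ i n, TopologicalSpace (C i n)] [∀ i n, LocallyCompactSpace (C i n)]
    {c : ∀ i n, C i n → C i (n + 1)} {ι : ∀ i n, C i n → X i}
    (h : ∀ i, IsSeqColimit (C i) (c i) (ι i)) :
    IsSeqColimit (fun n => ∀ i, C i n) (fun n x i => c i n (x i)) (fun n x i => ι i n (x i)) where
  continuous_trans n := continuous_pi fun i => ((h i).continuous_trans n).comp (continuous_apply i)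
  comp_trans n x := funext fun i => (h i).comp_trans n (x i)
  injective n x y hxy := funext fun i => (h i).injective n (congrFun hxy i)
  exists_rep := exists_rep_pi h
  isOpen_iff W := by
    cases nonempty_fintype I
    refine ⟨fun hW n => hW.preimage (continuous_pi fun i =>
      ((h i).continuous_ι n).comp (continuous_apply i)), fun hW => ?_⟩
    refine isOpen_iff_forall_mem_open.2 fun x hx => ?_
    obtain ⟨N, a, rfl⟩ : ∃ N, ∃ a : ∀ i, C i N, (fun i => ι i N (a i)) = x :=
      exists_rep_pi h x
    -- An open box around `x` inside `W` is built as an increasing union of compact boxes, one per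
    -- stage, each mapped by the transition into the interior of the next. Local compactness
    -- supplies the next box.
    let S : ℕ → Type _ := fun m => {A : ∀ i, Set (C i (N + m)) //
      (∀ i, IsCompact (A i)) ∧ Set.univ.pi A ⊆ (fun y i => ι i (N + m) (y i)) ⁻¹' W}
    have step : ∀ m (A : S m), ∃ B : S (m + 1), ∀ i,
        c i (N + m) '' A.1 i ⊆ interior (B.1 i) := by
      rintro m ⟨A, hA, hAW⟩
      obtain ⟨L, h1, h2, h3⟩ := exists_compact_box_between
        (fun i => (hA i).image ((h i).continuous_trans (N + m))) (hW (N + m + 1)) (by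
          intro y hy
          choose z hz hzy using fun i => hy i trivial
          have : (fun i => ι i (N + m) (z i)) ∈ W := hAW fun i _ => hz i
          simpa only [Set.mem_preimage, ← hzy, (h _).comp_trans] using this)
      exact ⟨⟨L, h1, h3⟩, h2⟩
    choose B hB using step
    let A : ∀ m, S m := fun m => Nat.rec ⟨fun i => {a i}, fun i => isCompact_singleton, by
      intro y hy
      obtain rfl : y = a := funext fun i => hy i trivial
      exact hx⟩ B m
    have hAB : ∀ m i, c i (N + m) '' (A m).1 i ⊆ interior ((A (m + 1)).1 i) := fun m => hB m (A m)
    have hmono : ∀ i, Monotone fun m => ι i (N + m) '' (A m).1 i := by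
      refine fun i => monotone_nat_of_le_succ fun m => ?_
      rintro _ ⟨b, hb, rfl⟩
      exact ⟨_, interior_subset (hAB m i ⟨b, hb, rfl⟩), (h i).comp_trans _ _⟩
    refine ⟨Set.univ.pi fun i => ⋃ m, ι i (N + m) '' (A m).1 i, fun y hy => ?_,
      isOpen_set_pi Set.finite_univ fun i _ => ?_, fun i _ => ?_⟩
    -- The coordinates of `y` may enter at different `m`. By monotonicity and finiteness of `I` a
    -- single compact box contains them all.
    · choose m hm using fun i => Set.mem_iUnion.1 (hy i trivial)
      choose b hb hby using fun i => hmono i (Finset.le_sup (f := m) (Finset.mem_univ i)) (hm i)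
      obtain rfl := funext hby
      exact (A (Finset.univ.sup m)).2.2 fun i _ => hb i
    · refine ((h i).isOpen_iff _).2 fun n => isOpen_iff_forall_mem_open.2 fun b hb => ?_
      obtain ⟨m, hm⟩ := Set.mem_iUnion.1 hb
      obtain ⟨b', hb', hbb'⟩ := hmono i (le_max_left m n) hm
      obtain ⟨g, hg, hg'⟩ := (h i).exists_trans
        (show n ≤ N + (max m n + 1) by have := le_max_right m n; omega)
      refine ⟨g ⁻¹' interior ((A (max m n + 1)).1 i), fun y hy => ?_,
        isOpen_interior.preimage hg, ?_⟩
      · exact Set.mem_iUnion.2 ⟨_, g y, interior_subset hy, hg' y⟩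
      -- Injectivity of the stage maps is used here: `g b` and `c i _ b'` agree in the colimit,
      -- hence already at their common stage.
      · have : g b = c i _ b' := (h i).injective _
          ((hg' b).trans (hbb'.symm.trans ((h i).comp_trans _ _).symm))
        rw [Set.mem_preimage, this]
        exact hAB _ i ⟨b', hb', rfl⟩
    · exact Set.mem_iUnion.2 ⟨0, a i, rfl, rfl⟩

/-! ### Topology of the Fulton--MacPherson operads -/

instance (d : ℕ) (A : Type) : T2Space (FM d A) :=
  inferInstanceAs (T2Space {z : Coord (E d) A // z ∈ closure _})

/-- Directions lie in closed unit balls and ratios in the compact space `[0,∞]`. With the Hausdorff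
property this gives the local compactness required of the stages of `FM_∞`. -/
instance (d : ℕ) (A : Type) : CompactSpace (FM d A) := by
  refine isCompact_iff_compactSpace.1 ((IsCompact.prod (isCompact_univ_pi fun _ : A =>
    isCompact_univ_pi fun _ : A => isCompact_closedBall (0 : E d) 1)
      isCompact_univ).closure_of_subset ?_)
  rintro _ ⟨p, -, rfl⟩
  refine ⟨fun i _ j _ => ?_, trivial⟩
  simp only [confCoord, mem_closedBall_zero_iff, norm_smul, norm_inv, norm_norm]
  exact inv_mul_le_one

lemma FM.continuous_val (d : ℕ) (A : Type) : Continuous fun p : FM d A => p.1 :=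
  continuous_subtype_val

lemma FM.continuous_dir {d : ℕ} {A : Type} (i j : A) (h : i ≠ j) :
    Continuous fun p : FM d A => p.dir i j h := by
  have := FM.continuous_val d A
  exact Continuous.subtype_mk (by fun_prop) _

lemma FM.continuous_incl {d e : ℕ} (hde : d ≤ e) (A : Type) :
    Continuous (FM.incl hde (A := A)) := by
  have := FM.continuous_val d A
  have := continuous_pad d e
  refine Continuous.subtype_mk ?_ _
  unfold Coord.map
  fun_prop

lemma FM.continuous_gamma {d n : ℕ} {k : Fin n → ℕ} :
    Continuous fun z : FM d (Fin n) × (∀ i, FM d (Fin (k i))) => z.1.gamma z.2 := by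
  have h1 := FM.continuous_val d (Fin n)
  have h2 := fun i => FM.continuous_val d (Fin (k i))
  refine Continuous.subtype_mk ((continuous_relabel _).comp (continuous_comp.comp
    (f := fun z : FM d (Fin n) × (∀ i, FM d (Fin (k i))) => (z.1.1, fun i => (z.2 i).1)) ?_)) _
  fun_prop

lemma padInf_injective (d : ℕ) : Function.Injective (padInf d) := by
  intro v w h
  ext k
  simpa [padInf] using congrFun h k

lemma FM.toInf_incl {d e : ℕ} (hde : d ≤ e) {A : Type} (p : FM d A) :
    (p.incl hde).toInf = p.toInf := by
  refine Subtype.ext ?_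
  simp only [FM.toInf, FM.incl, Coord.map, padInf_pad hde]

lemma FM.toInf_gamma {d n : ℕ} {k : Fin n → ℕ} (p : FM d (Fin n))
    (q : ∀ i, FM d (Fin (k i))) : (p.gamma q).toInf = p.toInf.gamma fun i => (q i).toInf :=
  Subtype.ext (congrArg (Coord.relabel finSigmaFinEquiv)
    (map_comp (padInf d) p.1 fun i => (q i).1))

lemma isSeqColimit_FMInf (A : Type) : IsSeqColimit (fun d => FM d A)
    (fun d => FM.incl d.le_succ) fun d => FM.toInf (d := d) (A := A) where
  continuous_trans d := FM.continuous_incl _ A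
  comp_trans d p := p.toInf_incl _
  injective d p q h := by
    have h := congrArg Subtype.val h
    refine Subtype.ext (Prod.ext ?_ (congrArg Prod.snd h :))
    funext i j
    exact padInf_injective d (congrFun (congrFun (congrArg Prod.fst h) i) j)
  exists_rep := by
    rintro ⟨z, d, p, rfl⟩
    exact ⟨d, p, rfl⟩
  isOpen_iff U := by
    simp only [isOpen_iSup_iff, isOpen_coinduced]

lemma FMInf.continuous_relabel {A : Type} (e : A ≃ A) :
    Continuous (FMInf.relabel (A := A) e) := by
  refine (isSeqColimit_FMInf A).continuous_iff.2 fun d => ?_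
  have h : Continuous (FM.relabel (d := d) e) :=
    Continuous.subtype_mk ((AtiyahEn.continuous_relabel e).comp (FM.continuous_val d A)) _
  exact ((isSeqColimit_FMInf A).continuous_ι d).comp h

/-- Keeping `p` in the compact space `FM d` allows `continuous_prod`. At stage `N` all
configurations are moved to dimension `max d N`, where composition is continuous before passing to
the colimit. -/
lemma continuous_gamma_toInf {d n : ℕ} {k : Fin n → ℕ} :
    Continuous fun z : FM d (Fin n) × (∀ i, FMInf (Fin (k i))) => z.1.toInf.gamma z.2 := by
  refine (IsSeqColimit.pi fun i => isSeqColimit_FMInf (Fin (k i))).continuous_prod fun N => ?_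
  have h : Continuous fun z : FM d (Fin n) × (∀ i, FM N (Fin (k i))) =>
      ((z.1.incl (le_max_left d N)).gamma fun i => (z.2 i).incl (le_max_right d N)).toInf := by
    have h1 := FM.continuous_incl (le_max_left d N) (Fin n)
    have h2 := fun i => FM.continuous_incl (le_max_right d N) (Fin (k i))
    refine ((isSeqColimit_FMInf _).continuous_ι _).comp (FM.continuous_gamma.comp
      (f := fun z : FM d (Fin n) × (∀ i, FM N (Fin (k i))) =>
        (z.1.incl (le_max_left d N), fun i => (z.2 i).incl (le_max_right d N))) ?_)
    fun_prop
  simpa only [FM.toInf_gamma, FM.toInf_incl] using h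

/-! ### Continuity of the multiplication of `BU(1)` and `BO(1)` -/

/-- The nonzero polynomials over `K`. -/
def NonzeroPoly (K : Type) [Field K] : Type := {f : K[X] // f ≠ 0}

section

variable {K : Type} [Field K]

/-- The nonzero polynomial with given coefficients, not all zero. -/
def NonzeroPoly.ofCoeffs (n : ℕ) (v : {v : Fin n → K // v ≠ 0}) : NonzeroPoly K :=
  ⟨AtiyahEn.ofCoeffs v.1, ofCoeffs_ne_zero v.2⟩

/-- The class of a nonzero polynomial in the projective space. -/
def NonzeroPoly.proj (f : NonzeroPoly K) : ProjPoly K := Projectivization.mk K f.1 f.2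

/-- Product of nonzero polynomials. -/
def NonzeroPoly.mul (f g : NonzeroPoly K) : NonzeroPoly K := ⟨f.1 * g.1, mul_ne_zero f.2 g.2⟩

/-- Appending a zero coefficient. -/
def appendZero (n : ℕ) (v : {v : Fin n → K // v ≠ 0}) : {v : Fin (n + 1) → K // v ≠ 0} :=
  ⟨Fin.snoc v.1 0, fun h => v.2 (funext fun i => by
    simpa using congrFun h i.castSucc)⟩

lemma coeff_ofCoeffs {n : ℕ} (v : Fin n → K) (m : ℕ) :
    (ofCoeffs v).coeff m = if h : m < n then v ⟨m, h⟩ else 0 := by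
  simp only [ofCoeffs, Polynomial.finsetSum_coeff, Polynomial.coeff_monomial]
  split_ifs with h
  · rw [Finset.sum_eq_single ⟨m, h⟩] <;> simp +contextual [Fin.ext_iff]
  · exact Finset.sum_eq_zero fun i _ => if_neg (by omega)

/-- The coefficients of the product of polynomials with given coefficients. -/
def mulCoeffs {n m : ℕ} (v : Fin n → K) (w : Fin m → K) (l : Fin (n + m)) : K :=
  ∑ i : Fin n, ∑ j : Fin m, if (i : ℕ) + j = l then v i * w j else 0

lemma ofCoeffs_mulCoeffs {n m : ℕ} (v : Fin n → K) (w : Fin m → K) :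
    ofCoeffs (mulCoeffs v w) = ofCoeffs v * ofCoeffs w := by
  have h : ofCoeffs v * ofCoeffs w = ∑ i : Fin n, ∑ j : Fin m,
      Polynomial.monomial ((i : ℕ) + j) (v i * w j) := by
    simp only [ofCoeffs, Finset.sum_mul_sum, Polynomial.monomial_mul_monomial]
  ext l
  rw [h, coeff_ofCoeffs]
  simp only [Polynomial.finsetSum_coeff, Polynomial.coeff_monomial, mulCoeffs]
  split_ifs with hl
  · rfl
  -- Exponents satisfy `i + j < n + m`, so no coefficient of the product is lost.
  · exact (Finset.sum_eq_zero fun i _ => Finset.sum_eq_zero fun j _ =>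
      if_neg (by omega)).symm

variable [TopologicalSpace K]

/-- The colimit topology. -/
instance : TopologicalSpace (NonzeroPoly K) :=
  ⨆ n : ℕ, TopologicalSpace.coinduced (NonzeroPoly.ofCoeffs (K := K) n) inferInstance

lemma continuous_nonzero_apply {n : ℕ} (i : Fin n) :
    Continuous fun v : {v : Fin n → K // v ≠ 0} => v.1 i :=
  (continuous_apply i).comp continuous_subtype_val

lemma isSeqColimit_nonzeroPoly : IsSeqColimit (fun n => {v : Fin n → K // v ≠ 0}) appendZero
    (NonzeroPoly.ofCoeffs (K := K)) where
  continuous_trans n := by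
    refine Continuous.subtype_mk (continuous_pi fun i => ?_) _
    induction i using Fin.lastCases with
    | last => simpa using continuous_const
    | cast i => simpa using continuous_nonzero_apply i
  comp_trans n v := by
    refine Subtype.ext (Polynomial.ext fun m => ?_)
    simp only [NonzeroPoly.ofCoeffs, appendZero, coeff_ofCoeffs]
    by_cases h : m < n
    · rw [dif_pos h, dif_pos (by omega)]
      exact Fin.snoc_castSucc (α := fun _ => K) 0 v.1 ⟨m, h⟩
    · rw [dif_neg h]
      split_ifs with h'
      · obtain rfl : m = n := by omega
        exact Fin.snoc_last (α := fun _ => K) 0 v.1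
      · rfl
  injective n v w h := by
    refine Subtype.ext (funext fun i => ?_)
    have := congrArg (fun f : NonzeroPoly K => f.1.coeff i) h
    simpa [NonzeroPoly.ofCoeffs, coeff_ofCoeffs] using this
  exists_rep := by
    rintro ⟨f, hf⟩
    have h : ofCoeffs (fun i : Fin (f.natDegree + 1) => f.coeff i) = f := by
      ext m
      rw [coeff_ofCoeffs]
      split_ifs with h
      · rfl
      · exact (Polynomial.coeff_eq_zero_of_natDegree_lt (by omega)).symm
    refine ⟨f.natDegree + 1, ⟨fun i => f.coeff i, ?_⟩, Subtype.ext h⟩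
    intro h0
    refine hf ?_
    rw [← h, h0]
    simp [ofCoeffs]
  isOpen_iff U := by
    simp only [isOpen_iSup_iff, isOpen_coinduced]

lemma NonzeroPoly.continuous_proj : Continuous (NonzeroPoly.proj (K := K)) := by
  refine isSeqColimit_nonzeroPoly.continuous_iff.2 fun n => ?_
  exact continuous_iSup_rng (i := n) continuous_coinduced_rng

/-- Multiplication by a unit of the field. -/
def NonzeroPoly.smul (a : Kˣ) (f : NonzeroPoly K) : NonzeroPoly K :=
  ⟨a • f.1, (smul_ne_zero_iff_ne a).2 f.2⟩

lemma NonzeroPoly.continuous_smul [ContinuousMul K] (a : Kˣ) :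
    Continuous (NonzeroPoly.smul (K := K) a) := by
  refine isSeqColimit_nonzeroPoly.continuous_iff.2 fun n => ?_
  have h : Continuous fun v : {v : Fin n → K // v ≠ 0} =>
      (⟨fun i => a * v.1 i, fun h => v.2 (funext fun i => by simpa using congrFun h i)⟩ :
        {v : Fin n → K // v ≠ 0}) := by
    exact Continuous.subtype_mk (continuous_pi fun i =>
      continuous_const.mul (continuous_nonzero_apply i)) _
  convert (isSeqColimit_nonzeroPoly.continuous_ι n).comp h using 1
  funext v
  refine Subtype.ext (Polynomial.ext fun m => ?_)
  simp [NonzeroPoly.smul, NonzeroPoly.ofCoeffs, coeff_ofCoeffs, Units.smul_def]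

/-- The saturation of an open set is the union of its preimages under multiplication by units.
Openness matters because it passes to the product of two copies of the projection, which is how
multiplication descends. -/
lemma NonzeroPoly.isOpenQuotientMap_proj [ContinuousMul K] :
    IsOpenQuotientMap (NonzeroPoly.proj (K := K)) where
  surjective := by
    rintro ⟨f⟩
    exact ⟨f, rfl⟩
  continuous := NonzeroPoly.continuous_proj
  isOpenMap U hU := by
    have h : NonzeroPoly.proj ⁻¹' (NonzeroPoly.proj '' U) =
        ⋃ a : Kˣ, NonzeroPoly.smul a ⁻¹' U := by
      ext f
      simp only [Set.mem_preimage, Set.mem_image, Set.mem_iUnion]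
      constructor
      · rintro ⟨g, hg, hgf⟩
        obtain ⟨a, ha⟩ := (Projectivization.mk_eq_mk_iff K _ _ g.2 f.2).1 hgf
        refine ⟨a, ?_⟩
        convert hg using 1
        exact Subtype.ext ha
      · rintro ⟨a, ha⟩
        exact ⟨_, ha, (Projectivization.mk_eq_mk_iff K _ _ _ f.2).2 ⟨a, rfl⟩⟩
    refine isOpen_iSup_iff.2 fun n => isOpen_coinduced.2 ?_
    have h2 : IsOpen (NonzeroPoly.proj ⁻¹' (NonzeroPoly.proj '' U)) := by
      rw [h]
      exact isOpen_iUnion fun a => hU.preimage (NonzeroPoly.continuous_smul a)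
    exact h2.preimage (isSeqColimit_nonzeroPoly.continuous_ι n)

variable [IsTopologicalRing K] [LocallyCompactSpace K] [T1Space K]

lemma NonzeroPoly.continuous_mul :
    Continuous fun z : NonzeroPoly K × NonzeroPoly K => z.1.mul z.2 := by
  have hlc : ∀ n, LocallyCompactSpace {v : Fin n → K // v ≠ 0} := fun n =>
    isOpen_ne.locallyCompactSpace
  -- The pair is indexed by `Bool` to apply `IsSeqColimit.pi`; on each stage the product is
  -- polynomial in the coefficients.
  have h : Continuous fun z : Bool → NonzeroPoly K => (z true).mul (z false) := by
    refine (IsSeqColimit.pi fun _ : Bool => isSeqColimit_nonzeroPoly (K := K)).continuous_iff.2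
      fun n => ?_
    have h : Continuous fun z : Bool → {v : Fin n → K // v ≠ 0} =>
        (⟨mulCoeffs (z true).1 (z false).1, fun h => mul_ne_zero (ofCoeffs_ne_zero (z true).2)
          (ofCoeffs_ne_zero (z false).2) (by
            rw [← ofCoeffs_mulCoeffs, h]
            simp [AtiyahEn.ofCoeffs])⟩ : {v : Fin (n + n) → K // v ≠ 0}) := by
      refine Continuous.subtype_mk (continuous_pi fun l => ?_) _
      refine continuous_finsetSum _ fun i _ => continuous_finsetSum _ fun j _ => ?_
      have hc : ∀ b i, Continuous fun z : Bool → {v : Fin n → K // v ≠ 0} => (z b).1 i :=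
        fun b i => (continuous_nonzero_apply i).comp (continuous_apply b)
      split_ifs
      · exact (hc true i).mul (hc false j)
      · exact continuous_const
    convert (isSeqColimit_nonzeroPoly.continuous_ι (n + n)).comp h using 1
    funext z
    exact Subtype.ext (ofCoeffs_mulCoeffs _ _).symm
  have h2 : Continuous fun z : NonzeroPoly K × NonzeroPoly K => fun b : Bool =>
      cond b z.1 z.2 := by
    refine continuous_pi fun b => ?_
    cases b
    · exact continuous_snd
    · exact continuous_fst
  exact h.comp h2

instance : ContinuousMul (ProjPoly K) where
  continuous_mul := by
    have h := NonzeroPoly.isOpenQuotientMap_proj (K := K)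
    refine (h.prodMap h).continuous_comp_iff.1 ?_
    exact NonzeroPoly.continuous_proj.comp NonzeroPoly.continuous_mul

end

/-! ### The algebraic identities of the twisted actions -/

/-- The point of `D X` represented by a configuration with labels. -/
def D.mk {X : Type} {n : ℕ} (z : FMInf (Fin n) × (Fin n → X)) : D X :=
  ⟨n, Quotient.mk (extPowSetoid n X) z⟩

lemma D.exists_eq_mk {X : Type} {n : ℕ} (y : Fin n → D X) :
    ∃ (k : Fin n → ℕ) (q : ∀ i, FMInf (Fin (k i)) × (Fin (k i) → X)),
      y = fun i => D.mk (q i) := by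
  choose q hq using fun i => Quotient.exists_rep (y i).2
  exact ⟨_, q, funext fun i => Sigma.ext rfl (heq_of_eq (hq i).symm)⟩

/-- Block sums computed in two ways are equal only propositionally. Comparing along a bijection `Fin
n ≃ Fin m` avoids casts; once `n = m` it is the permutation relating the representatives. -/
lemma D.mk_eq_mk {X : Type} {n m : ℕ} {z : FMInf (Fin n) × (Fin n → X)}
    {w : FMInf (Fin m) × (Fin m → X)} (e : Fin n ≃ Fin m)
    (h1 : ∀ i j, z.1.1.1 i j = w.1.1.1 (e i) (e j))
    (h2 : ∀ i j k, z.1.1.2 i j k = w.1.1.2 (e i) (e j) (e k))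
    (h3 : ∀ i, z.2 i = w.2 (e i)) : D.mk z = D.mk w := by
  obtain rfl : n = m := by simpa using Fintype.card_congr e
  refine congrArg (Sigma.mk n) (Quotient.sound ⟨e, Subtype.ext (Prod.ext ?_ ?_), ?_⟩)
  · funext i j
    simp [FMInf.relabel, Coord.relabel, h1]
  · funext i j k
    simp [FMInf.relabel, Coord.relabel, h2]
  · funext i
    simp [h3]

lemma freeAct_mk {X : Type} {n : ℕ} (p : FMInf (Fin n)) {k : Fin n → ℕ}
    (q : ∀ i, FMInf (Fin (k i)) × (Fin (k i) → X)) :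
    freeAct p (fun i => D.mk (q i)) = D.mk (glue p q) := by
  refine congrArg (Sigma.mk _) ?_
  simp only [D.mk]
  exact congrFun (Quotient.finLiftOn_mk (S := fun i => extPowSetoid (k i) X) q) _ ▸ rfl

section coordinates

variable {V A : Type} {B : A → Type} (z : Coord V A) (w : ∀ a, Coord V (B a))

lemma comp_dir_same (a : A) (s t : B a) : (z.comp w).1 ⟨a, s⟩ ⟨a, t⟩ = (w a).1 s t := by
  simp [Coord.comp]

lemma comp_dir_ne {a b : A} (h : a ≠ b) (s : B a) (t : B b) :
    (z.comp w).1 ⟨a, s⟩ ⟨b, t⟩ = z.1 a b := by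
  simp [Coord.comp, h]

lemma comp_ratio_same (a : A) (s t u : B a) :
    (z.comp w).2 ⟨a, s⟩ ⟨a, t⟩ ⟨a, u⟩ = (w a).2 s t u := by
  simp [Coord.comp]

lemma comp_ratio_ne {a b c : A} (h : ¬(a = c ∧ b = c)) (s : B a) (t : B b) (u : B c) :
    (z.comp w).2 ⟨a, s⟩ ⟨b, t⟩ ⟨c, u⟩ = z.2 a b c := by
  simp [Coord.comp, h]

variable {X : Type} {n : ℕ} {k : Fin n → ℕ} (p : FMInf (Fin n))
  (q : ∀ i, FMInf (Fin (k i)) × (Fin (k i) → X))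

lemma glue_dir (s t : Σ i, Fin (k i)) :
    (glue p q).1.1.1 (finSigmaFinEquiv s) (finSigmaFinEquiv t) =
      (p.1.comp fun i => (q i).1.1).1 s t := by
  simp only [glue, FMInf.gamma, FMInf.relabel, Coord.relabel]
  rw [Equiv.symm_apply_apply, Equiv.symm_apply_apply]
  rfl

lemma glue_ratio (s t u : Σ i, Fin (k i)) :
    (glue p q).1.1.2 (finSigmaFinEquiv s) (finSigmaFinEquiv t) (finSigmaFinEquiv u) =
      (p.1.comp fun i => (q i).1.1).2 s t u := by
  simp only [glue, FMInf.gamma, FMInf.relabel, Coord.relabel]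
  rw [Equiv.symm_apply_apply, Equiv.symm_apply_apply, Equiv.symm_apply_apply]
  rfl

lemma glue_label (s : Σ i, Fin (k i)) :
    (glue p q).2 (finSigmaFinEquiv s) = (q s.1).2 s.2 := by
  simp only [glue]
  rw [Equiv.symm_apply_apply]

variable {d : ℕ} (p : FM d (Fin n)) (q : ∀ i, FM d (Fin (k i)))

lemma FM.gamma_dir (s t : Σ i, Fin (k i)) :
    (p.gamma q).1.1 (finSigmaFinEquiv s) (finSigmaFinEquiv t) =
      (p.1.comp fun i => (q i).1).1 s t := by
  simp only [FM.gamma, FM.relabel, Coord.relabel]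
  rw [Equiv.symm_apply_apply, Equiv.symm_apply_apply]
  rfl

lemma FM.gamma_ratio (s t u : Σ i, Fin (k i)) :
    (p.gamma q).1.2 (finSigmaFinEquiv s) (finSigmaFinEquiv t) (finSigmaFinEquiv u) =
      (p.1.comp fun i => (q i).1).2 s t u := by
  simp only [FM.gamma, FM.relabel, Coord.relabel]
  rw [Equiv.symm_apply_apply, Equiv.symm_apply_apply, Equiv.symm_apply_apply]
  rfl

/-- The bijection reordering the labels of a two-fold operadic composition. -/
def assocEquiv {n : ℕ} {k : Fin n → ℕ} (m : Fin (∑ i, k i) → ℕ) :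
    Fin (∑ i, ∑ j, m (finSigmaFinEquiv ⟨i, j⟩)) ≃ Fin (∑ s, m s) :=
  finSigmaFinEquiv.symm.trans
    (((Equiv.sigmaCongrRight fun _ => finSigmaFinEquiv.symm).trans
      ((Equiv.sigmaAssoc fun i (j : Fin (k i)) => Fin (m (finSigmaFinEquiv ⟨i, j⟩))).symm.trans
        (Equiv.sigmaCongrLeft (β := fun s => Fin (m s)) finSigmaFinEquiv))).trans
      finSigmaFinEquiv)

lemma assocEquiv_apply {n : ℕ} {k : Fin n → ℕ} (m : Fin (∑ i, k i) → ℕ) (i : Fin n)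
    (j : Fin (k i)) (s : Fin (m (finSigmaFinEquiv ⟨i, j⟩))) :
    assocEquiv m (finSigmaFinEquiv ⟨i, finSigmaFinEquiv ⟨j, s⟩⟩) =
      finSigmaFinEquiv ⟨finSigmaFinEquiv ⟨i, j⟩, s⟩ := by
  simp only [assocEquiv, Equiv.trans_apply, Equiv.symm_apply_apply, Equiv.sigmaCongrRight_apply]
  rfl

lemma exists_finSigmaFinEquiv₂ {n : ℕ} {k : Fin n → ℕ} {m : Fin (∑ i, k i) → ℕ}
    (s : Fin (∑ i, ∑ j, m (finSigmaFinEquiv ⟨i, j⟩))) :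
    ∃ (i : Fin n) (j : Fin (k i)) (t : Fin (m (finSigmaFinEquiv ⟨i, j⟩))),
      finSigmaFinEquiv ⟨i, finSigmaFinEquiv ⟨j, t⟩⟩ = s := by
  obtain ⟨⟨i, s⟩, rfl⟩ := finSigmaFinEquiv.surjective s
  obtain ⟨⟨j, t⟩, rfl⟩ := finSigmaFinEquiv.surjective s
  exact ⟨i, j, t, rfl⟩

end coordinates

variable {d : ℕ} {M : Type} [CommMonoid M]

lemma twistedAct_mk (f : USphere d → M) {n : ℕ} (p : FM d (Fin n)) {k : Fin n → ℕ}
    (q : ∀ i, FMInf (Fin (k i)) × (Fin (k i) → M)) :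
    twistedAct f n p (fun i => D.mk (q i)) =
      D.mk (glue p.toInf fun i => ((q i).1, fun s => weightedMap f k p i * (q i).2 s)) :=
  freeAct_mk _ _

/-- A product over all labels, with factor 1 at `i`, can be reindexed and split into blocks. -/
lemma weightedMap_eq (f : USphere d → M) {n : ℕ} (w : Fin n → ℕ) (p : FM d (Fin n)) (i : Fin n) :
    weightedMap f w p i =
      ∏ j, if h : i = j then 1 else f (p.dir i j h) ^ w j := by
  rw [weightedMap, ← Fintype.prod_subtype_mul_prod_subtype fun j => j ≠ i]
  rw [Finset.prod_eq_one (s := (Finset.univ : Finset {j // ¬j ≠ i})), mul_one]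
  · exact Finset.prod_congr rfl fun j _ => by rw [dif_neg j.2.symm]
  · exact fun j _ => dif_pos (not_not.1 j.2).symm

/-- This is the cocycle identity behind associativity. A block `j ≠ i` is seen from block `i` in the
single direction `x_{ij}(p)`, so its weights add up in the exponent; block `i` itself contributes
the directions of `q i`. -/
lemma weightedMap_gamma (f : USphere d → M) {n : ℕ} {k : Fin n → ℕ} (p : FM d (Fin n))
    (q : ∀ i, FM d (Fin (k i))) (w : Fin (∑ i, k i) → ℕ) (i : Fin n) (a : Fin (k i)) :
    weightedMap f w (p.gamma q) (finSigmaFinEquiv ⟨i, a⟩) =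
      weightedMap f (fun i => ∑ j, w (finSigmaFinEquiv ⟨i, j⟩)) p i *
        weightedMap f (fun j => w (finSigmaFinEquiv ⟨i, j⟩)) (q i) a := by
  simp only [weightedMap_eq]
  rw [← Equiv.prod_comp finSigmaFinEquiv, Fintype.prod_sigma]
  -- Block `i` is separated from the others; on the outer side its factor is 1.
  rw [← Finset.mul_prod_erase _ _ (Finset.mem_univ i), ← Finset.mul_prod_erase
    (s := Finset.univ) (f := fun j => if h : i = j then 1 else f (p.dir i j h) ^ _)
    (h := Finset.mem_univ i), dif_pos rfl, one_mul, mul_comm]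
  congr 1
  · refine Finset.prod_congr rfl fun j hj => ?_
    have hij : i ≠ j := (Finset.ne_of_mem_erase hj).symm
    rw [dif_neg hij, ← Finset.prod_pow_eq_pow_sum]
    refine Finset.prod_congr rfl fun b _ => ?_
    rw [dif_neg (by simp [hij])]
    congr 2
    exact Subtype.ext ((FM.gamma_dir p q _ _).trans (comp_dir_ne p.1 (fun i => (q i).1) hij a b))
  · refine Finset.prod_congr rfl fun b _ => ?_
    by_cases hab : a = b
    · rw [dif_pos hab, dif_pos (by rw [hab])]
    · rw [dif_neg hab, dif_neg (by simpa using hab)]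
      congr 2
      exact Subtype.ext ((FM.gamma_dir p q _ _).trans (comp_dir_same p.1 (fun i => (q i).1) i a b))

lemma twistedAct_unit (f : USphere d → M) (x : D M) :
    twistedAct f 1 (FM.unit d) (fun _ => x) = x := by
  obtain ⟨k, x⟩ := x
  obtain ⟨q, rfl⟩ := Quotient.exists_rep x
  change twistedAct f 1 (FM.unit d) (fun _ => D.mk q) = D.mk q
  have h0 : weightedMap f (fun _ => k) (FM.unit d) 0 = 1 := by simp [weightedMap_eq]
  let e : Fin k ≃ Fin (∑ _ : Fin 1, k) :=
    (Equiv.uniqueSigma fun _ : Fin 1 => Fin k).symm.trans finSigmaFinEquiv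
  have he : ∀ i, e i = finSigmaFinEquiv ⟨0, i⟩ := fun _ => rfl
  rw [twistedAct_mk f (FM.unit d) (k := fun _ => k) fun _ => q]
  symm
  refine D.mk_eq_mk e (fun i j => ?_) (fun i j l => ?_) fun i => ?_
  · rw [he, he, glue_dir, comp_dir_same]
  · rw [he, he, he, glue_ratio, comp_ratio_same]
  · rw [he, glue_label]
    exact (one_mul _).symm.trans (congrArg (· * _) h0.symm)

lemma twistedAct_equivariant (f : USphere d → M) {n : ℕ} (σ : Equiv.Perm (Fin n))
    (p : FM d (Fin n)) (x : Fin n → D M) :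
    twistedAct f n (p.relabel σ) x = twistedAct f n p (x ∘ σ) := by
  obtain ⟨k, q, rfl⟩ := D.exists_eq_mk x
  change _ = twistedAct f n p fun i => D.mk (q (σ i))
  have hw : ∀ i, weightedMap f k (p.relabel σ) (σ i) = weightedMap f (fun i => k (σ i)) p i := by
    intro i
    simp only [weightedMap_eq]
    rw [← Equiv.prod_comp σ]
    refine Finset.prod_congr rfl fun j _ => ?_
    by_cases h : i = j
    · simp [h]
    · rw [dif_neg h, dif_neg (by simpa using h)]
      congr 2
      refine Subtype.ext ?_
      simp [FM.dir, FM.relabel, Coord.relabel]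
  rw [twistedAct_mk, twistedAct_mk]
  symm
  let e : Fin (∑ i, k (σ i)) ≃ Fin (∑ i, k i) := finSigmaFinEquiv.symm.trans
    ((Equiv.sigmaCongrLeft (β := fun i => Fin (k i)) σ).trans finSigmaFinEquiv)
  have he : ∀ i (s : Fin (k (σ i))), e (finSigmaFinEquiv ⟨i, s⟩) = finSigmaFinEquiv ⟨σ i, s⟩ := by
    intro i s
    simp only [e, Equiv.trans_apply, Equiv.symm_apply_apply]
    rfl
  refine D.mk_eq_mk e (fun s t => ?_) (fun s t u => ?_) fun s => ?_
  · obtain ⟨⟨i, s⟩, rfl⟩ := finSigmaFinEquiv.surjective s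
    obtain ⟨⟨j, t⟩, rfl⟩ := finSigmaFinEquiv.surjective t
    rw [he, he, glue_dir, glue_dir]
    by_cases h : i = j
    · subst h
      rw [comp_dir_same, comp_dir_same]
    · rw [comp_dir_ne _ _ h, comp_dir_ne _ _ (σ.injective.ne h)]
      simp [FM.toInf, FM.relabel, Coord.relabel, Coord.map]
  · obtain ⟨⟨i, s⟩, rfl⟩ := finSigmaFinEquiv.surjective s
    obtain ⟨⟨j, t⟩, rfl⟩ := finSigmaFinEquiv.surjective t
    obtain ⟨⟨l, u⟩, rfl⟩ := finSigmaFinEquiv.surjective u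
    rw [he, he, he, glue_ratio, glue_ratio]
    by_cases h : i = l ∧ j = l
    · obtain ⟨rfl, rfl⟩ := h
      rw [comp_ratio_same, comp_ratio_same]
    · rw [comp_ratio_ne _ _ h, comp_ratio_ne _ _ (by simpa using h)]
      simp [FM.toInf, FM.relabel, Coord.relabel, Coord.map]
  · obtain ⟨⟨i, s⟩, rfl⟩ := finSigmaFinEquiv.surjective s
    rw [he, glue_label, glue_label]
    exact congrArg (· * _) (hw i).symm

lemma twistedAct_assoc (f : USphere d → M) {n : ℕ} {k : Fin n → ℕ} (p : FM d (Fin n))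
    (q : ∀ i, FM d (Fin (k i))) (x : Fin (∑ i, k i) → D M) :
    twistedAct f (∑ i, k i) (p.gamma q) x =
      twistedAct f n p fun i => twistedAct f (k i) (q i) fun j => x (finSigmaFinEquiv ⟨i, j⟩) := by
  obtain ⟨m, r, rfl⟩ := D.exists_eq_mk x
  simp only [twistedAct_mk]
  symm
  refine D.mk_eq_mk (assocEquiv m) (fun s t => ?_) (fun s t u => ?_) fun s => ?_
  · obtain ⟨i, j, s, rfl⟩ := exists_finSigmaFinEquiv₂ s
    obtain ⟨i', j', t, rfl⟩ := exists_finSigmaFinEquiv₂ t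
    rw [assocEquiv_apply, assocEquiv_apply, glue_dir, glue_dir]
    by_cases h : i = i'
    · subst h
      rw [comp_dir_same, glue_dir]
      by_cases h' : j = j'
      · subst h'
        rw [comp_dir_same, comp_dir_same]
      · rw [comp_dir_ne _ _ h', comp_dir_ne _ _ (by simpa using h')]
        exact congrArg (padInf d) ((FM.gamma_dir p q _ _).trans (comp_dir_same _ _ _ _ _)).symm
    · rw [comp_dir_ne _ _ h, comp_dir_ne _ _ (by simp [h])]
      exact congrArg (padInf d) ((FM.gamma_dir p q _ _).trans (comp_dir_ne _ _ h _ _)).symm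
  · obtain ⟨i, j, s, rfl⟩ := exists_finSigmaFinEquiv₂ s
    obtain ⟨i', j', t, rfl⟩ := exists_finSigmaFinEquiv₂ t
    obtain ⟨i'', j'', u, rfl⟩ := exists_finSigmaFinEquiv₂ u
    rw [assocEquiv_apply, assocEquiv_apply, assocEquiv_apply, glue_ratio, glue_ratio]
    by_cases h : i = i'' ∧ i' = i''
    · obtain ⟨rfl, rfl⟩ := h
      rw [comp_ratio_same, glue_ratio]
      by_cases h' : j = j'' ∧ j' = j''
      · obtain ⟨rfl, rfl⟩ := h'
        rw [comp_ratio_same, comp_ratio_same]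
      · rw [comp_ratio_ne _ _ h', comp_ratio_ne _ _ (by simpa using h')]
        exact ((FM.gamma_ratio p q _ _ _).trans (comp_ratio_same _ _ _ _ _ _)).symm
    · rw [comp_ratio_ne _ _ h, comp_ratio_ne _ _ (by
        simp only [EmbeddingLike.apply_eq_iff_eq, Sigma.mk.injEq]
        exact fun h' => h ⟨h'.1.1, h'.2.1⟩)]
      exact ((FM.gamma_ratio p q _ _ _).trans (comp_ratio_ne _ _ h _ _ _)).symm
  · obtain ⟨i, j, s, rfl⟩ := exists_finSigmaFinEquiv₂ s
    rw [assocEquiv_apply, glue_label, glue_label]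
    dsimp only
    rw [glue_label]
    dsimp only
    -- The outer weights are the sizes of the inner composites, which are exactly the sums in the
    -- cocycle identity.
    rw [weightedMap_gamma, mul_assoc]

/-! ### Continuity of the twisted actions -/

/-- The saturation of an open set is the union of its preimages under the permutations. Openness
survives finite products, unlike the property of being a quotient map. -/
lemma isOpenMap_extPow_mk (n : ℕ) (X : Type) [TopologicalSpace X] :
    IsOpenMap (fun z => (Quotient.mk (extPowSetoid n X) z : ExtPow n X)) := by
  intro U hU
  have hσ : ∀ σ : Equiv.Perm (Fin n), Continuous fun z : FMInf (Fin n) × (Fin n → X) =>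
      (z.1.relabel σ, z.2 ∘ σ.symm) := fun σ =>
    ((FMInf.continuous_relabel σ).comp continuous_fst).prodMk (continuous_pi fun i =>
      (continuous_apply (σ.symm i)).comp continuous_snd)
  have h : (fun z => (Quotient.mk (extPowSetoid n X) z : ExtPow n X)) ⁻¹'
      ((fun z => (Quotient.mk (extPowSetoid n X) z : ExtPow n X)) '' U) =
        ⋃ σ : Equiv.Perm (Fin n), (fun z : FMInf (Fin n) × (Fin n → X) =>
          (z.1.relabel σ, z.2 ∘ σ.symm)) ⁻¹' U := by
    ext z
    simp only [Set.mem_preimage, Set.mem_image, Set.mem_iUnion]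
    constructor
    · rintro ⟨w, hw, hwz⟩
      obtain ⟨σ, h1, h2⟩ := Quotient.exact hwz.symm
      refine ⟨σ, ?_⟩
      rw [h1, h2]
      exact hw
    · rintro ⟨σ, hz⟩
      exact ⟨_, hz, (Quotient.sound (s := extPowSetoid n X) ⟨σ, rfl, rfl⟩).symm⟩
  refine isOpen_coinduced.2 ?_
  exact h ▸ isOpen_iUnion fun σ => hU.preimage (hσ σ)

lemma D.continuous_mk {X : Type} [TopologicalSpace X] {n : ℕ} :
    Continuous (D.mk (X := X) (n := n)) :=
  continuous_sigmaMk.comp continuous_quotient_mk'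

lemma D.isOpenMap_mk {X : Type} [TopologicalSpace X] {n : ℕ} :
    IsOpenMap (D.mk (X := X) (n := n)) :=
  isOpenMap_sigmaMk.comp (isOpenMap_extPow_mk n X)

/-- A map is continuous if its compositions with a jointly surjective family of open maps are. -/
lemma continuous_of_isOpenMap_family {α X Y : Type*} {Z : α → Type*} [TopologicalSpace X]
    [TopologicalSpace Y] [∀ a, TopologicalSpace (Z a)] {g : X → Y} (e : ∀ a, Z a → X)
    (he : ∀ a, IsOpenMap (e a)) (hs : ∀ x, ∃ a z, e a z = x)
    (hg : ∀ a, Continuous (g ∘ e a)) : Continuous g := by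
  refine ⟨fun U hU => ?_⟩
  have h : g ⁻¹' U = ⋃ a, e a '' ((g ∘ e a) ⁻¹' U) := by
    ext x
    simp only [Set.mem_iUnion, Set.mem_image]
    constructor
    · intro hx
      obtain ⟨a, z, rfl⟩ := hs x
      exact ⟨a, z, hx, rfl⟩
    · rintro ⟨a, z, hz, rfl⟩
      exact hz
  rw [h]
  exact isOpen_iUnion fun a => he a _ (hU.preimage (hg a))

variable {d : ℕ} {M : Type} [CommMonoid M]

lemma restrict_twistedAct {e : ℕ} (hde : d ≤ e) (f : USphere e → M) :
    (twistedAct f).restrict hde = twistedAct fun x => f (sphereIncl hde x) := by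
  funext n p y
  rw [FMAction.restrict, twistedAct, FM.toInf_incl]
  rfl

lemma twistedAct_one : twistedAct (fun _ : USphere d => (1 : M)) = classicalAct d M := by
  funext n p y
  obtain ⟨k, q, rfl⟩ := D.exists_eq_mk y
  rw [twistedAct_mk, classicalAct, freeAct_mk]
  simp [weightedMap]

lemma restrict_classicalAct {e : ℕ} (hde : d ≤ e) :
    (classicalAct e M).restrict hde = classicalAct d M := by
  rw [← twistedAct_one, restrict_twistedAct, twistedAct_one]

variable [TopologicalSpace M] [ContinuousMul M]

lemma continuous_weightedMap {T : Type*} [TopologicalSpace T] {f : T → USphere d → M}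
    (hf : Continuous (Function.uncurry f)) {n : ℕ} (w : Fin n → ℕ) (i : Fin n) :
    Continuous fun z : T × FM d (Fin n) => weightedMap (f z.1) w z.2 i := by
  refine continuous_finsetProd _ fun j _ => Continuous.pow ?_ _
  exact hf.comp (continuous_fst.prodMk
    ((FM.continuous_dir i j.1 j.2.symm).comp continuous_snd))

/-- After lifting to representatives, the configuration does not involve the parameter and the
labels are products of continuous maps. Hence `T` may be arbitrary, and one statement covers both
single structures and homotopies. -/
lemma continuous_twistedAct {T : Type*} [TopologicalSpace T] {f : T → USphere d → M}
    (hf : Continuous (Function.uncurry f)) (n : ℕ) :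
    Continuous fun z : T × FM d (Fin n) × (Fin n → D M) =>
      twistedAct (f z.1) n z.2.1 z.2.2 := by
  refine continuous_of_isOpenMap_family (α := Fin n → ℕ)
    (Z := fun k => T × FM d (Fin n) × (∀ i, FMInf (Fin (k i)) × (Fin (k i) → M)))
    (fun k => Prod.map id (Prod.map id (Pi.map fun i => D.mk))) (fun k => ?_) ?_ fun k => ?_
  · exact IsOpenMap.id.prodMap (IsOpenMap.id.prodMap
      (IsOpenMap.piMap (fun i => D.isOpenMap_mk) (by simp)))
  · rintro ⟨t, p, y⟩
    obtain ⟨k, q, rfl⟩ := D.exists_eq_mk y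
    exact ⟨k, (t, p, q), rfl⟩
  · have h : Continuous fun z : T × FM d (Fin n) ×
        (∀ i, FMInf (Fin (k i)) × (Fin (k i) → M)) => D.mk (glue z.2.1.toInf fun i =>
          ((z.2.2 i).1, fun s => weightedMap (f z.1) k z.2.1 i * (z.2.2 i).2 s)) := by
      refine D.continuous_mk.comp (Continuous.prodMk ?_ (continuous_pi fun s => ?_))
      · refine continuous_gamma_toInf.comp (f := fun z : T × FM d (Fin n) ×
          (∀ i, FMInf (Fin (k i)) × (Fin (k i) → M)) => (z.2.1, fun i => (z.2.2 i).1)) ?_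
        fun_prop
      · have hw := continuous_weightedMap hf k (finSigmaFinEquiv.symm s).1
        refine Continuous.mul (hw.comp (f := fun z : T × FM d (Fin n) ×
          (∀ i, FMInf (Fin (k i)) × (Fin (k i) → M)) => (z.1, z.2.1)) ?_) ?_ <;> fun_prop
    exact h.congr fun z => (twistedAct_mk (f z.1) z.2.1 z.2.2).symm

lemma isFMAlgebra_twistedAct {f : USphere d → M} (hf : Continuous f) :
    IsFMAlgebra d (D M) (twistedAct f) where
  continuous n := by
    have h := continuous_twistedAct (T := Unit) (f := fun _ => f) (hf.comp continuous_snd) n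
    exact h.comp (continuous_const.prodMk continuous_id : Continuous fun z => ((), z))
  unit := twistedAct_unit f
  equivariant _ σ p x := twistedAct_equivariant f σ p x
  assoc _ _ p q x := twistedAct_assoc f p q x

lemma isFMAlgebra_classicalAct : IsFMAlgebra d (D M) (classicalAct d M) :=
  twistedAct_one (d := d) (M := M) ▸ isFMAlgebra_twistedAct continuous_const

/-- A homotopy from a constant map to the standard inclusion induces a homotopy from the
classical structure to a twisted structure. -/
lemma isFMHomotopy_twistedAct {e : ℕ} (hde : d ≤ e) {f : USphere e → M} (hf : Continuous f)
    {N : USphere e} (hN : f N = 1) (h : C(unitInterval × USphere d, USphere e))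
    (h0 : ∀ x, h (0, x) = N) (h1 : ∀ x, h (1, x) = sphereIncl hde x) :
    IsFMHomotopy d (D M) ((classicalAct e M).restrict hde) ((twistedAct f).restrict hde)
      (fun t => twistedAct fun x => f (h (t, x))) where
  isFMAlgebra t := isFMAlgebra_twistedAct
    (hf.comp (h.continuous.comp (continuous_const.prodMk continuous_id)))
  continuous n := continuous_twistedAct (f := fun t x => f (h (t, x))) (hf.comp h.continuous) n
  zero := by simp only [h0, hN, twistedAct_one, restrict_classicalAct]
  one := by simp only [h1, restrict_twistedAct]

/-! ### The maps from spheres to projective spaces -/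

/-- The class of a linear polynomial with given coefficients. -/
def linProj {K : Type} [Field K] (v : {v : Fin 2 → K // v ≠ 0}) : ProjPoly K :=
  (NonzeroPoly.ofCoeffs 2 v).proj

lemma linProj_eq_mk {K : Type} [Field K] (v : {v : Fin 2 → K // v ≠ 0}) {f : K[X]} (hf : f ≠ 0)
    (a : K)
    (h : Polynomial.C (v.1 0) + Polynomial.C (v.1 1) * Polynomial.X = Polynomial.C a * f) :
    linProj v = Projectivization.mk K f hf := by
  refine (Projectivization.mk_eq_mk_iff' K _ _ _ _).2 ⟨a, ?_⟩
  rw [Polynomial.smul_eq_C_mul, ← h]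
  simp [NonzeroPoly.ofCoeffs, ofCoeffs, Polynomial.C_mul_X_eq_monomial]

/-- `F` is given by two systems of homogeneous coordinates whose nonvanishing loci are open and
cover `S`. -/
lemma continuous_of_linProj {K S : Type} [Field K] [TopologicalSpace K] [T1Space K]
    [TopologicalSpace S] {F : S → ProjPoly K} {u v : S → Fin 2 → K} (hu : Continuous u)
    (hv : Continuous v) (huF : ∀ s (h : u s ≠ 0), F s = linProj ⟨u s, h⟩)
    (hvF : ∀ s (h : v s ≠ 0), F s = linProj ⟨v s, h⟩) (huv : ∀ s, u s ≠ 0 ∨ v s ≠ 0) :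
    Continuous F := by
  have key : ∀ w : S → Fin 2 → K, Continuous w → (∀ s (h : w s ≠ 0), F s = linProj ⟨w s, h⟩) →
      ∀ s, w s ≠ 0 → ContinuousAt F s := by
    intro w hw hwF s hs
    have h : ContinuousOn F {s | w s ≠ 0} := by
      rw [continuousOn_iff_continuous_domRestrict]
      have h2 : Continuous fun s : {s | w s ≠ 0} => linProj ⟨w s.1, s.2⟩ :=
        (NonzeroPoly.continuous_proj.comp (isSeqColimit_nonzeroPoly.continuous_ι 2)).comp
          (Continuous.subtype_mk (hw.comp continuous_subtype_val) _)
      exact h2.congr fun s => (hwF s.1 s.2).symm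
    exact h.continuousAt ((isOpen_ne.preimage hw).mem_nhds hs)
  refine continuous_iff_continuousAt.2 fun s => ?_
  rcases huv s with h | h
  · exact key u hu huF s h
  · exact key v hv hvF s h

open Classical in
/-- The inverse of the stereographic projection, followed by the inclusion of the projective
line in the infinite projective space, is continuous. -/
lemma continuous_stereographic {K S : Type} [RCLike K] [TopologicalSpace S] {w : S → K}
    {h : S → ℝ} (hw : Continuous w) (hh : Continuous h) (hs : ∀ s, ‖w s‖ ^ 2 + h s ^ 2 = 1) :
    Continuous fun s => if h s = 1 then (1 : ProjPoly K) else linClass (w s / (1 - (h s : K))) := by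
  have hh' : Continuous fun s => (h s : K) := RCLike.continuous_ofReal.comp hh
  have hk : ∀ s, w s * (starRingEnd K) (w s) = (1 - (h s : K)) * (1 + (h s : K)) := by
    intro s
    rw [RCLike.mul_conj]
    have := congrArg (fun x : ℝ => (x : K)) (hs s)
    push_cast at this
    linear_combination this
  have hne : ∀ s, h s ≠ 1 → (1 - (h s : K)) ≠ 0 := fun s hs' h0 => hs' (by
    have h2 : ((1 - h s : ℝ) : K) = 0 := by push_cast; exact h0
    linarith [RCLike.ofReal_eq_zero.1 h2])
  have hw1 : ∀ s, h s = 1 → w s = 0 := fun s hs' => by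
    have := hs s
    rw [hs'] at this
    simpa using this
  -- The polynomials are `(1 - h) X - w` and `w̄ X - (1 + h)`, proportional because `w w̄ = (1 -
  -- h)(1 + h)`. The first degenerates only at the north pole, where the second is the constant
  -- `-2`.
  refine continuous_of_linProj (u := fun s => ![-w s, 1 - (h s : K)])
    (v := fun s => ![-(1 + (h s : K)), (starRingEnd K) (w s)]) ?_ ?_ (fun s hs' => ?_)
    (fun s hs' => ?_) fun s => ?_
  · refine continuous_pi fun i => ?_
    fin_cases i
    · exact hw.neg
    · exact continuous_const.sub hh'
  · refine continuous_pi fun i => ?_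
    fin_cases i
    · exact (continuous_const.add hh').neg
    · exact RCLike.continuous_conj.comp hw
  · by_cases h1 : h s = 1
    · exact absurd (by simp [h1, hw1 s h1]) hs'
    · rw [if_neg h1]
      refine (linProj_eq_mk _ _ (1 - (h s : K)) ?_).symm
      rw [mul_sub, ← Polynomial.C_mul, mul_div_cancel₀ _ (hne s h1)]
      simp
      ring
  · by_cases h1 : h s = 1
    · rw [if_pos h1]
      refine (linProj_eq_mk _ one_ne_zero (-2) ?_).symm
      simp [h1, hw1 s h1]
      norm_num
      exact (map_ofNat Polynomial.C 2).symm
    · rw [if_neg h1]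
      refine (linProj_eq_mk _ _ ((starRingEnd K) (w s)) ?_).symm
      have : (starRingEnd K) (w s) * (w s / (1 - (h s : K))) = 1 + h s := by
        rw [mul_div_assoc', mul_comm, hk, mul_div_cancel_left₀ _ (hne s h1)]
      rw [mul_sub, ← Polynomial.C_mul, this]
      simp
      ring
  · by_cases h1 : h s = 1
    · refine Or.inr fun h0 => ?_
      have := congrFun h0 0
      norm_num [h1] at this
    · refine Or.inl fun h0 => hne s h1 ?_
      simpa using congrFun h0 1

lemma continuous_sphere_apply {d : ℕ} (i : Fin d) : Continuous fun v : USphere d => v.1 i := by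
  fun_prop

lemma sum_sq_sphere {d : ℕ} (v : USphere d) : ∑ i, v.1 i ^ 2 = 1 := by
  have h : ‖v.1‖ ^ 2 = 1 := by simp
  rw [EuclideanSpace.norm_sq_eq] at h
  simpa using h

lemma continuous_sphereToBU1 : Continuous sphereToBU1 := by
  have h0 := continuous_sphere_apply (d := 3) 0
  have h1 := continuous_sphere_apply (d := 3) 1
  refine continuous_stereographic (K := ℂ)
    (w := fun v : USphere 3 => (v.1 0 : ℂ) + (v.1 1 : ℂ) * Complex.I) (h := fun v => v.1 2)
    (by fun_prop) (continuous_sphere_apply 2) fun v => ?_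
  have := sum_sq_sphere v
  rw [Fin.sum_univ_three] at this
  rw [Complex.sq_norm, Complex.normSq_add_mul_I]
  exact this

lemma continuous_sphereToBO1 : Continuous sphereToBO1 := by
  refine continuous_stereographic (K := ℝ)
    (w := fun v : USphere 2 => v.1 0) (h := fun v => v.1 1)
    (continuous_sphere_apply 0) (continuous_sphere_apply 1) fun v => ?_
  have := sum_sq_sphere v
  rw [Fin.sum_univ_two] at this
  simpa using this

lemma sphereToBU1_northPole : sphereToBU1 (northPole 2) = 1 :=
  if_pos (by simp [northPole, show (2 : Fin 3) = Fin.last 2 from rfl])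

lemma sphereToBO1_northPole : sphereToBO1 (northPole 1) = 1 :=
  if_pos (by simp [northPole, show (1 : Fin 2) = Fin.last 1 from rfl])

/-! ### The meridian homotopy and its endpoints -/

/-- The homotopy moving the equator of the sphere to the north pole along meridians. -/
def meridianHomotopy (d : ℕ) : C(unitInterval × USphere d, USphere (d + 1)) where
  toFun z := ⟨Real.sin (Real.pi / 2 * z.1) • pad d (d + 1) z.2.1 +
    Real.cos (Real.pi / 2 * z.1) • (northPole d).1, by
      -- Padded vectors have last coordinate zero, hence are orthogonal to the pole; the norm is
      -- then 1 by `sin² + cos² = 1`.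
      have h : inner ℝ (pad d (d + 1) z.2.1) (northPole d).1 = 0 := by
        simp [northPole, EuclideanSpace.inner_single_right, pad]
      have h2 : ‖Real.sin (Real.pi / 2 * z.1) • pad d (d + 1) z.2.1 +
          Real.cos (Real.pi / 2 * z.1) • (northPole d).1‖ ^ 2 = 1 := by
        rw [norm_add_sq_real, norm_smul, norm_smul, inner_smul_left, inner_smul_right, h,
          norm_pad d.le_succ]
        simp
      rw [mem_sphere_zero_iff_norm]
      exact (pow_eq_one_iff_of_nonneg (norm_nonneg _) two_ne_zero).1 h2⟩
  continuous_toFun := by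
    have := continuous_pad d (d + 1)
    refine Continuous.subtype_mk ?_ _
    fun_prop

lemma meridianHomotopy_zero (d : ℕ) (x : USphere d) :
    meridianHomotopy d (0, x) = northPole d :=
  Subtype.ext (by simp [meridianHomotopy])

lemma meridianHomotopy_one (d : ℕ) (x : USphere d) :
    meridianHomotopy d (1, x) = sphereIncl d.le_succ x :=
  Subtype.ext (by simp [meridianHomotopy, sphereIncl])

end AtiyahEn

end

theorem mainTheorem7 :
    (AtiyahEn.IsFMAlgebra 3 (AtiyahEn.D AtiyahEn.BU1) (AtiyahEn.classicalAct 3 AtiyahEn.BU1) ∧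
      AtiyahEn.IsFMAlgebra 3 (AtiyahEn.D AtiyahEn.BU1) AtiyahEn.atiyahComplex ∧
      ∃ h : C(unitInterval × AtiyahEn.USphere 2, AtiyahEn.USphere 3),
        (∀ x, h (0, x) = AtiyahEn.northPole 2) ∧
        (∀ x, h (1, x) = AtiyahEn.sphereIncl (by norm_num) x) ∧
        AtiyahEn.IsFMHomotopy 2 (AtiyahEn.D AtiyahEn.BU1)
          ((AtiyahEn.classicalAct 3 AtiyahEn.BU1).restrict (by norm_num))
          (AtiyahEn.atiyahComplex.restrict (by norm_num))
          (fun t => AtiyahEn.twistedAct fun x => AtiyahEn.sphereToBU1 (h (t, x)))) ∧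
    (AtiyahEn.IsFMAlgebra 2 (AtiyahEn.D AtiyahEn.BO1) (AtiyahEn.classicalAct 2 AtiyahEn.BO1) ∧
      AtiyahEn.IsFMAlgebra 2 (AtiyahEn.D AtiyahEn.BO1) AtiyahEn.atiyahReal ∧
      ∃ h : C(unitInterval × AtiyahEn.USphere 1, AtiyahEn.USphere 2),
        (∀ x, h (0, x) = AtiyahEn.northPole 1) ∧
        (∀ x, h (1, x) = AtiyahEn.sphereIncl (by norm_num) x) ∧
        AtiyahEn.IsFMHomotopy 1 (AtiyahEn.D AtiyahEn.BO1)
          ((AtiyahEn.classicalAct 2 AtiyahEn.BO1).restrict (by norm_num))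
          (AtiyahEn.atiyahReal.restrict (by norm_num))
          (fun t => AtiyahEn.twistedAct fun x => AtiyahEn.sphereToBO1 (h (t, x)))) := by
  refine ⟨⟨AtiyahEn.isFMAlgebra_classicalAct,
    AtiyahEn.isFMAlgebra_twistedAct AtiyahEn.continuous_sphereToBU1, AtiyahEn.meridianHomotopy 2,
    AtiyahEn.meridianHomotopy_zero 2, AtiyahEn.meridianHomotopy_one 2, ?_⟩,
    AtiyahEn.isFMAlgebra_classicalAct,
    AtiyahEn.isFMAlgebra_twistedAct AtiyahEn.continuous_sphereToBO1, AtiyahEn.meridianHomotopy 1,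
    AtiyahEn.meridianHomotopy_zero 1, AtiyahEn.meridianHomotopy_one 1, ?_⟩
  · exact AtiyahEn.isFMHomotopy_twistedAct _ AtiyahEn.continuous_sphereToBU1
      AtiyahEn.sphereToBU1_northPole _ (AtiyahEn.meridianHomotopy_zero 2)
      (AtiyahEn.meridianHomotopy_one 2)
  · exact AtiyahEn.isFMHomotopy_twistedAct _ AtiyahEn.continuous_sphereToBO1
      AtiyahEn.sphereToBO1_northPole _ (AtiyahEn.meridianHomotopy_zero 1)
      (AtiyahEn.meridianHomotopy_one 1)
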